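/- Let $\mathbb K$ be a field of characteristic zero. The algebra $\mathcal A(P)$. Let $\mathcal A(P)$ be the $\mathbb K$-vector space with basis $P_{m_1\ldots m_k}$ ($k\ge 1$, $m_i\ge 1$ integers), with $P:=P_1$ and the bilinear products $$P_{m_1\ldots m_k}\prec P_{n_1\ldots n_l}=P_{m_1\ldots m_k n_1\ldots n_l},\qquad P_{m_1\ldots m_k}\bullet P_{n_1\ldots n_l}=P_{m_1\ldots m_{k-1}\,(m_k+n_1)\,n_2\ldots n_l},$$ and $\alpha\succ\beta:=\alpha\prec\beta+\alpha\bullet\beta$. The main product $\circ$ is the bilinear product for which $P_{m_1\ldots m_k}\circ P_{n_1\ldots n_l}$ is the sum over all $\binom{k+l}{k}$ shuffles of the sequences $(m_1,\ldots,m_k)$ and $(n_1,\ldots,n_l)$ of the product of the corresponding elements $P_{m_i}$, $P_{n_j}$ in the shuffled order, where neighbours are joined by $\succ$ if the left one comes from the first sequence and the right one from the second, and by $\prec$ otherwise. For $k=0$ we set $P_{m_1\ldots m_k}\circ\alpha:=\alpha$. The algebra $\mathcal R$. Let $\mathcal R_0$ be the free (noncommutative, unital) algebra of differential polynomials in $u_2,u_3,\ldots$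 over $\mathbb K$ with derivation $\partial_x$. Formal pseudo-differential operators are the formal series $\sum_{i\le N}X_i\partial^i$ with $X_i\in\mathcal R_0$, $N\in\mathbb Z$, multiplied by means of $\partial^i f=\sum_{l\ge0}\binom{i}{l}(\partial_x^l f)\,\partial^{i-l}$; the product is denoted by $*$. $X_{\ge0}$ and $X_{<0}$ are the parts of $X$ with non-negative, respectively negative, powers of $\partial$. Let $L=\partial+\sum_{n\ge1}u_{n+1}\partial^{-n}$ and let $\mathcal R$ be the algebra generated by $L$ and $\partial^{-1}$ by means of linear combinations, the product $*$ and the projection $(\,)_{\ge0}$. Put $$X\vartriangle Y:=X_{\ge0}*Y_{\ge0}-X_{<0}*Y_{<0}.$$ The maps $\ell,r$. Let $\ell,r:\mathcal A(P)\to\mathcal R$ be the linear maps determined by $\ell(P)=r(P)=L$ and $$\ell(\alpha\prec P)=-\ell(\alpha)_{<0}*L,\quad \ell(\alpha\succ P)=\ell(\alpha)_{\ge0}*L,\quad r(P\prec\alpha)=-L*r(\alpha)_{\ge0},\quad r(P\succ\alpha)=L*r(\alpha)_{<0},$$ and write $L^{m_1,\ldots,m_k}:=\ell(P_{m_1\ldots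 m_k})$. The operators $\delta$. Consider families of linear operators $\delta_{m_1\ldots m_k}$ on $\mathcal R$ ($k\ge0$, $m_i\ge1$), equal to $\mathrm{id}$ for $k=0$, such that $$\delta_{m_1\ldots m_k}L=-[L^{m_1,\ldots,m_k}_{<0},L]+\sum_{j=1}^{k-1}(\delta_{m_1\ldots m_j}L)*L^{m_{j+1},\ldots,m_k}_{<0}\qquad(k\ge1),$$ $$\delta_{m_1\ldots m_k}(X_{\ge0})=(\delta_{m_1\ldots m_k}X)_{\ge0},\qquad \delta_{m_1\ldots m_k}(X*Y)=\sum_{j=0}^k(\delta_{m_1\ldots m_j}X)*(\delta_{m_{j+1}\ldots m_k}Y)\qquad(X,Y\in\mathcal R).$$ **Proposition.** There is exactly one such family, and for all $k\ge1$, all integers $m_1,\ldots,m_k\ge1$ and all $\alpha\in\mathcal A(P)$ it satisfies $$\delta_{m_1\ldots m_k}\,\ell(\alpha)=\ell(P_{m_1\ldots m_k}\circ\alpha)-\sum_{j=0}^{k-1}\ell(P_{m_1\ldots m_j}\circ\alpha)\vartriangle r(P_{m_{j+1}\ldots m_k}),$$ $$\delta_{m_1\ldots m_k}\,r(\alpha)=r(P_{m_1\ldots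 m_k}\circ\alpha)+\sum_{j=1}^{k}\ell(P_{m_1\ldots m_j})\vartriangle r(P_{m_{j+1}\ldots m_k}\circ\alpha).$$ -/

import Mathlib

namespace NcKP

noncomputable section

/-! ## Differential polynomials -/

/-- The free (noncommutative, associative, unital) differential polynomial algebra over `K` in the
functions `u₂, u₃, …`. The free generator `(n, j)` is the `j`-th `x`-derivative of `u_{n+2}`. -/
abbrev DiffPoly (K : Type*) [Field K] : Type _ := FreeAlgebra K (ℕ × ℕ)

section DiffPoly

variable (K : Type*) [Field K]

/-- The algebra map `f ↦ f + ε f_x` (with `ε² = 0`). -/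
def dualHom : DiffPoly K →ₐ[K] TrivSqZeroExt (DiffPoly K) (DiffPoly K) :=
  FreeAlgebra.lift K fun p : ℕ × ℕ =>
    TrivSqZeroExt.inl (FreeAlgebra.ι K p) + TrivSqZeroExt.inr (FreeAlgebra.ι K (p.1, p.2 + 1))

/-- The derivation `∂ₓ` of the algebra of differential polynomials. -/
def dx : DiffPoly K →ₗ[K] DiffPoly K :=
  (TrivSqZeroExt.sndHom (DiffPoly K) (DiffPoly K)).restrictScalars K ∘ₗ (dualHom K).toLinearMap

theorem dx_ι (n j : ℕ) : dx K (FreeAlgebra.ι K (n, j)) = FreeAlgebra.ι K (n, j + 1) := by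
  simp [dx, dualHom]

theorem fst_dualHom (f : DiffPoly K) : (dualHom K f).fst = f := by
  have h : (TrivSqZeroExt.fstHom K (DiffPoly K) (DiffPoly K)).comp (dualHom K)
      = AlgHom.id K (DiffPoly K) := by
    apply FreeAlgebra.hom_ext
    funext p
    simp [dualHom]
  exact congrArg (fun φ => φ f) h

/-- The Leibniz rule; together with `dx_ι` and linearity it determines `∂ₓ`. -/
theorem dx_mul (f g : DiffPoly K) : dx K (f * g) = dx K f * g + f * dx K g := by
  simp [dx, fst_dualHom, TrivSqZeroExt.snd_mul, add_comm]

end DiffPoly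

/-! ## Formal pseudo-differential operators -/

/-- A formal pseudo-differential operator `∑_{i ≤ N} X_i ∂^i`, given by its coefficients
`X_i`, `i ∈ ℤ`, written to the left of the powers of `∂`. -/
def psiSubmodule (K : Type*) [Field K] : Submodule K (ℤ → DiffPoly K) where
  carrier := {X | ∃ N : ℤ, ∀ i, N < i → X i = 0}
  add_mem' := by
    rintro X Y ⟨N, hN⟩ ⟨M, hM⟩
    refine ⟨max N M, fun i hi => ?_⟩
    simp [hN i (lt_of_le_of_lt (le_max_left _ _) hi), hM i (lt_of_le_of_lt (le_max_right _ _) hi)]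
  zero_mem' := ⟨0, fun _ _ => rfl⟩
  smul_mem' := by
    rintro c X ⟨N, hN⟩
    exact ⟨N, fun i hi => by simp [hN i hi]⟩

/-- The type of formal pseudo-differential operators. -/
def PsiDO (K : Type*) [Field K] : Type _ := psiSubmodule K

section PsiDO

variable {K : Type*} [Field K]

instance : AddCommGroup (PsiDO K) := inferInstanceAs (AddCommGroup (psiSubmodule K))

instance : Module K (PsiDO K) := inferInstanceAs (Module K (psiSubmodule K))

namespace PsiDO

/-- The coefficients of a pseudo-differential operator. -/
def coeff : PsiDO K →ₗ[K] (ℤ → DiffPoly K) := (psiSubmodule K).subtype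

/-- The pseudo-differential operator with given coefficients. -/
def ofFun (X : ℤ → DiffPoly K) (h : ∃ N : ℤ, ∀ i, N < i → X i = 0) : PsiDO K := ⟨X, h⟩

@[simp] theorem coeff_ofFun (X : ℤ → DiffPoly K) (h : ∃ N : ℤ, ∀ i, N < i → X i = 0) :
    coeff (ofFun X h) = X := rfl

theorem exists_bound (X : PsiDO K) : ∃ N : ℤ, ∀ i, N < i → coeff X i = 0 := X.2

theorem ext {X Y : PsiDO K} (h : ∀ i, coeff X i = coeff Y i) : X = Y := Subtype.ext (funext h)

end PsiDO

/-- The contribution to the coefficient of `∂^n` in `X ∗ Y` of the `l`-th term of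
`∂^i f = ∑_{l ≥ 0} (i choose l) f^{(l)} ∂^{i-l}`, with `p = (i, l)`. -/
def mulTerm (X Y : ℤ → DiffPoly K) (n : ℤ) (p : ℤ × ℕ) : DiffPoly K :=
  Ring.choose p.1 p.2 • (X p.1 * (dx K)^[p.2] (Y (n + p.2 - p.1)))

theorem mulTerm_eq_zero {X Y : ℤ → DiffPoly K} {N M : ℤ} (hX : ∀ i, N < i → X i = 0)
    (hY : ∀ i, M < i → Y i = 0) (n : ℤ) (p : ℤ × ℕ)
    (h : N < p.1 ∨ M < n + p.2 - p.1) : mulTerm X Y n p = 0 := by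
  rcases h with h | h
  · simp [mulTerm, hX _ h]
  · simp [mulTerm, hY _ h]

theorem mulTerm_finite (X Y : PsiDO K) (n : ℤ) :
    (Function.support (mulTerm X.coeff Y.coeff n)).Finite := by
  obtain ⟨N, hN⟩ := X.exists_bound
  obtain ⟨M, hM⟩ := Y.exists_bound
  refine ((Set.finite_Icc (n - M) N).prod (Set.finite_Iic (N + M - n).toNat)).subset ?_
  intro p hp
  have h := mt (mulTerm_eq_zero hN hM n p) hp
  simp only [Set.mem_prod, Set.mem_Icc, Set.mem_Iic]
  omega

/-- The product `∗` of pseudo-differential operators; the sum has finitely many nonzero terms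
by `mulTerm_finite`. -/
instance : Mul (PsiDO K) where
  mul X Y := PsiDO.ofFun (fun n => ∑ᶠ p : ℤ × ℕ, mulTerm X.coeff Y.coeff n p) (by
    obtain ⟨N, hN⟩ := X.exists_bound
    obtain ⟨M, hM⟩ := Y.exists_bound
    refine ⟨N + M, fun n hn => ?_⟩
    rw [← finsum_zero (α := ℤ × ℕ)]
    exact finsum_congr fun p => mulTerm_eq_zero hN hM n p (by omega))

namespace PsiDO

theorem coeff_mul (X Y : PsiDO K) (n : ℤ) :
    coeff (X * Y) n = ∑ᶠ p : ℤ × ℕ, mulTerm X.coeff Y.coeff n p := rfl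

theorem add_mul (X Y Z : PsiDO K) : (X + Y) * Z = X * Z + Y * Z := by
  apply PsiDO.ext
  intro n
  have h := finsum_add_distrib (mulTerm_finite X Z n) (mulTerm_finite Y Z n)
  rw [map_add, Pi.add_apply, coeff_mul, coeff_mul, coeff_mul, ← h]
  refine finsum_congr fun p => ?_
  simp [mulTerm, _root_.add_mul, smul_add]

theorem mul_add (X Y Z : PsiDO K) : X * (Y + Z) = X * Y + X * Z := by
  apply PsiDO.ext
  intro n
  have h := finsum_add_distrib (mulTerm_finite X Y n) (mulTerm_finite X Z n)
  rw [map_add, Pi.add_apply, coeff_mul, coeff_mul, coeff_mul, ← h]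
  refine finsum_congr fun p => ?_
  simp [mulTerm, _root_.mul_add, smul_add, iterate_map_add]

theorem smul_mul (c : K) (X Y : PsiDO K) : (c • X) * Y = c • (X * Y) := by
  apply PsiDO.ext
  intro n
  rw [map_smul, Pi.smul_apply, coeff_mul, coeff_mul, smul_finsum' c (mulTerm_finite X Y n)]
  refine finsum_congr fun p => ?_
  simp [mulTerm]

theorem mul_smul (c : K) (X Y : PsiDO K) : X * (c • Y) = c • (X * Y) := by
  apply PsiDO.ext
  intro n
  have hd : ∀ (l : ℕ) (f : DiffPoly K), (dx K)^[l] (c • f) = c • (dx K)^[l] f := by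
    intro l f
    rw [← Module.End.pow_apply, ← Module.End.pow_apply, map_smul]
  rw [map_smul, Pi.smul_apply, coeff_mul, coeff_mul, smul_finsum' c (mulTerm_finite X Y n)]
  refine finsum_congr fun p => ?_
  simp [mulTerm, hd]

/-- The projection `X ↦ X_{≥0}` to the non-negative powers of `∂`. -/
def nonneg : PsiDO K →ₗ[K] PsiDO K where
  toFun X := ofFun (fun i => if 0 ≤ i then coeff X i else 0) (by
    obtain ⟨N, hN⟩ := X.exists_bound
    exact ⟨N, fun i hi => by simp [hN i hi]⟩)
  map_add' X Y := PsiDO.ext fun i => by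
    by_cases h : 0 ≤ i <;> simp [h]
  map_smul' c X := PsiDO.ext fun i => by
    by_cases h : 0 ≤ i <;> simp [h]

theorem coeff_nonneg (X : PsiDO K) (i : ℤ) :
    coeff (nonneg X) i = if 0 ≤ i then coeff X i else 0 := rfl

end PsiDO

variable (K)

/-- The generic operator `L = ∂ + ∑_{n ≥ 1} u_{n+1} ∂^{-n}`. -/
def PsiDO.L : PsiDO K :=
  PsiDO.ofFun
    (fun i => if i = 1 then 1 else if i < 0 then FreeAlgebra.ι K ((-i - 1).toNat, 0) else 0)
    ⟨1, fun i hi => by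
      have h1 : i ≠ 1 := by omega
      have h2 : ¬ i < 0 := by omega
      simp [h1, h2]⟩

/-- The operator `∂⁻¹`. -/
def PsiDO.dinv : PsiDO K :=
  PsiDO.ofFun (fun i => if i = -1 then 1 else 0) ⟨-1, fun i hi => if_neg (by omega)⟩

/-- Membership in the algebra generated by `L` and `∂⁻¹` by means of linear combinations,
the product `∗` and the projection `( )_{≥0}`. Note `∂ = L_{≥0}`, `1 = ∂ ∗ ∂⁻¹` and
`X_{<0} = X - X_{≥0}`. -/
inductive Generated : PsiDO K → Prop
  | L : Generated (PsiDO.L K)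
  | dinv : Generated (PsiDO.dinv K)
  | add {X Y : PsiDO K} : Generated X → Generated Y → Generated (X + Y)
  | smul (c : K) {X : PsiDO K} : Generated X → Generated (c • X)
  | mul {X Y : PsiDO K} : Generated X → Generated Y → Generated (X * Y)
  | nonneg {X : PsiDO K} : Generated X → Generated (PsiDO.nonneg X)

/-- The algebra `𝓡` of pseudo-differential operators generated by the generic `L`. -/
def generatedSubmodule : Submodule K (PsiDO K) where
  carrier := {X | Generated K X}
  add_mem' := Generated.add
  zero_mem' := by
    have h := Generated.smul (0 : K) (Generated.L (K := K))
    rw [zero_smul] at h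
    exact h
  smul_mem' c _ := Generated.smul c

/-- The type of elements of `𝓡`. -/
def RAlg : Type _ := generatedSubmodule K

end PsiDO

section RAlg

variable {K : Type*} [Field K]

instance : AddCommGroup (RAlg K) := inferInstanceAs (AddCommGroup (generatedSubmodule K))

instance : Module K (RAlg K) := inferInstanceAs (Module K (generatedSubmodule K))

instance : Mul (RAlg K) := ⟨fun X Y => ⟨X.1 * Y.1, Generated.mul X.2 Y.2⟩⟩

/-- `L` as an element of `𝓡`. -/
def L : RAlg K := ⟨PsiDO.L K, Generated.L⟩

/-- `X ↦ X_{≥0}` on `𝓡`. -/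
def pos : RAlg K →ₗ[K] RAlg K :=
  PsiDO.nonneg.restrict (p := generatedSubmodule K) (q := generatedSubmodule K)
    fun _ hX => Generated.nonneg hX

/-- `X ↦ X_{<0}` on `𝓡`. -/
def neg : RAlg K →ₗ[K] RAlg K := LinearMap.id - pos (K := K)

/-- `X △ Y = X_{≥0} ∗ Y_{≥0} - X_{<0} ∗ Y_{<0}`. -/
def tri (X Y : RAlg K) : RAlg K := pos X * pos Y - neg X * neg Y

theorem pos_add_neg (X : RAlg K) : pos X + neg X = X := by simp [neg]

/-- Right multiplication by `L`. -/
def mulL : RAlg K →ₗ[K] RAlg K where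
  toFun X := X * L
  map_add' X Y := Subtype.ext (PsiDO.add_mul X.1 Y.1 _)
  map_smul' c X := Subtype.ext (PsiDO.smul_mul c X.1 _)

/-- Left multiplication by `L`. -/
def Lmul : RAlg K →ₗ[K] RAlg K where
  toFun X := L * X
  map_add' X Y := Subtype.ext (PsiDO.mul_add _ X.1 Y.1)
  map_smul' c X := Subtype.ext (PsiDO.mul_smul c _ X.1)

end RAlg

/-! ## The algebra `𝓐(P)` (without unit) -/

/-- Nonempty words `m₁ … m_k` in positive integers. -/
abbrev Word : Type := {w : List ℕ+ // w ≠ []}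

/-- `𝓐(P)`: the vector space with basis `P_{m₁…m_k} = P_{m₁} ≺ ⋯ ≺ P_{m_k}`, where
`P_m = P • ⋯ • P` (`m` factors). -/
abbrev AP (K : Type*) [Field K] : Type _ := Word →₀ K

section AP

variable {K : Type*} [Field K]

/-- The basis element `P_{m₁…m_k}` of a nonempty word (and, as a dummy value, `0` for the
empty word). -/
def P (w : List ℕ+) : AP K := if h : w ≠ [] then Finsupp.single ⟨w, h⟩ 1 else 0

/-- Bilinear extension of a product of basis elements. -/
def bilin (f : Word → Word → AP K) : AP K →ₗ[K] AP K →ₗ[K] AP K :=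
  Finsupp.linearCombination K fun u => Finsupp.linearCombination K (f u)

/-- The product `≺`: `P_{m₁…m_k} ≺ P_{n₁…n_l} = P_{m₁…m_k n₁…n_l}`. -/
def prec : AP K →ₗ[K] AP K →ₗ[K] AP K := bilin fun u v => P (u.1 ++ v.1)

/-- The product `•`: `P_{m₁…m_k} • P_{n₁…n_l} = P_{m₁…m_{k-1}, m_k + n₁, n₂…n_l}`. -/
def bullet : AP K →ₗ[K] AP K →ₗ[K] AP K :=
  bilin fun u v => P (u.1.dropLast ++ (u.1.getLast u.2 + v.1.head v.2) :: v.1.tail)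

/-- The product `α ≻ β = α ≺ β + α • β`. -/
def succ : AP K →ₗ[K] AP K →ₗ[K] AP K := prec + bullet

/-- All shuffles of two decks `u`, `v` (listed with multiplicity, one for each
`(k, l)`-shuffle permutation); the tags `Sum.inl`, `Sum.inr` record the deck that each card
comes from. -/
def shuffles : List ℕ+ → List ℕ+ → List (List (ℕ+ ⊕ ℕ+))
  | [], v => [v.map Sum.inr]
  | u, [] => [u.map Sum.inl]
  | a :: u, b :: v =>
    (shuffles u (b :: v)).map (Sum.inl a :: ·) ++ (shuffles (a :: u) v).map (Sum.inr b :: ·)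
termination_by u v => u.length + v.length

/-- The element of `𝓐(P)` of a shuffled deck: neighbouring cards are joined by `≻` if the left one
is from the first deck and the right one from the second; they are joined by `≺` in the opposite
case, and also if both are from the same deck (since the cards of both decks, being the factors of
basis elements, were joined by `≺` before shuffling). -/
def evalShuffle : List (ℕ+ ⊕ ℕ+) → AP K
  | [] => 0
  | [x] => P [x.elim id id]
  | Sum.inl m :: Sum.inr n :: t => succ (P [m]) (evalShuffle (Sum.inr n :: t))
  | x :: y :: t => prec (P [x.elim id id]) (evalShuffle (y :: t))

/-- The main product `∘`, the mixable shuffle product. -/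
def circ : AP K →ₗ[K] AP K →ₗ[K] AP K :=
  bilin fun u v => ((shuffles u.1 v.1).map evalShuffle).sum

/-- `P_{m₁…m_k} ∘ α`, with the convention that it is `α` for `k = 0`. -/
def Pcirc (w : List ℕ+) (α : AP K) : AP K := if w = [] then α else circ (P w) α

end AP

/-! ## The maps `ℓ` and `r` -/

section ellr

variable {K : Type*} [Field K]

/-- `ℓ` on basis elements, by recursion on the reversed word:
`ℓ(P) = L`, `ℓ(α ≺ P) = - ℓ(α)_{<0} ∗ L`, and `ℓ(α • P) = ℓ(α) ∗ L`. -/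
def ellRev : List ℕ+ → RAlg K
  | [] => 0
  | [m] => mulL^[(m : ℕ) - 1] L
  | m :: n :: t => mulL^[(m : ℕ) - 1] (-(neg (ellRev (n :: t)) * L))

/-- The linear map `ℓ : 𝓐(P) → 𝓡`; see `ell_P`, `ell_prec_P`, `ell_succ_P`. -/
def ell : AP K →ₗ[K] RAlg K := Finsupp.linearCombination K fun w => ellRev w.1.reverse

/-- `r` on basis elements, by recursion on the word:
`r(P) = L`, `r(P ≺ α) = - L ∗ r(α)_{≥0}`, and `r(P • α) = L ∗ r(α)`. -/
def rWord : List ℕ+ → RAlg K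
  | [] => 0
  | [m] => Lmul^[(m : ℕ) - 1] L
  | m :: n :: t => Lmul^[(m : ℕ) - 1] (-(L * pos (rWord (n :: t))))

/-- The linear map `r : 𝓐(P) → 𝓡`; see `r_P`, `r_P_prec`, `r_P_succ`. -/
def r : AP K →ₗ[K] RAlg K := Finsupp.linearCombination K fun w => rWord w.1

theorem ell_single (w : Word) : ell (Finsupp.single w (1 : K)) = ellRev w.1.reverse := by
  simp [ell]

theorem r_single (w : Word) : r (Finsupp.single w (1 : K)) = rWord w.1 := by
  simp [r]

theorem P_ne {w : List ℕ+} (h : w ≠ []) : (P w : AP K) = Finsupp.single ⟨w, h⟩ 1 := dif_pos h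

theorem bilin_single (f : Word → Word → AP K) (u v : Word) :
    bilin f (Finsupp.single u 1) (Finsupp.single v 1) = f u v := by
  simp [bilin]

/-- `P_{m n₁…n_l} = P_m ≺ P_{n₁…n_l}`. -/
theorem P_cons (m : ℕ+) {w : List ℕ+} (h : w ≠ []) :
    (P (m :: w) : AP K) = prec (P [m]) (P w) := by
  rw [P_ne (w := [m]) (by simp), P_ne h, prec, bilin_single]
  rfl

/-- `P_{m+1} = P_m • P`. -/
theorem P_add_one (m : ℕ+) : (P [m + 1] : AP K) = bullet (P [m]) (P [1]) := by
  rw [P_ne (w := [m]) (by simp), P_ne (w := [1]) (by simp), bullet, bilin_single]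
  rfl

theorem ell_P : ell (P [1] : AP K) = L := by
  rw [P_ne (by simp), ell_single]
  simp [ellRev]

theorem r_P : r (P [1] : AP K) = L := by
  rw [P_ne (by simp), r_single]
  simp [rWord]

theorem ell_prec_P (α : AP K) : ell (prec α (P [1])) = -(neg (ell α) * L) := by
  suffices h : ell ∘ₗ (prec.flip (P [1])) = -(mulL ∘ₗ neg ∘ₗ (ell (K := K))) from
    congrArg (fun φ => φ α) h
  apply Finsupp.lhom_ext'
  intro u
  ext1
  obtain ⟨w, hw⟩ := u
  have e : ell (prec (Finsupp.single ⟨w, hw⟩ (1 : K)) (P [1]))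
      = -(neg (ell (Finsupp.single ⟨w, hw⟩ (1 : K))) * L) := by
    rw [P_ne (w := [1]) (by simp), prec, bilin_single, P_ne (by simp), ell_single, ell_single]
    obtain ⟨n, t, ht⟩ := List.exists_cons_of_ne_nil (mt List.reverse_eq_nil_iff.1 hw)
    simp [ht, ellRev]
  exact e

theorem ell_bullet_P (α : AP K) : ell (bullet α (P [1])) = ell α * L := by
  suffices h : ell ∘ₗ (bullet.flip (P [1])) = mulL ∘ₗ (ell (K := K)) from
    congrArg (fun φ => φ α) h
  apply Finsupp.lhom_ext'
  intro u
  ext1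
  obtain ⟨w, hw⟩ := u
  have e : ell (bullet (Finsupp.single ⟨w, hw⟩ (1 : K)) (P [1]))
      = mulL (ell (Finsupp.single ⟨w, hw⟩ (1 : K))) := by
    rw [P_ne (w := [1]) (by simp), bullet, bilin_single, P_ne (by simp), ell_single, ell_single]
    rcases List.eq_nil_or_concat w with rfl | ⟨t, m, rfl⟩
    · exact absurd rfl hw
    · have hm : ((m + 1 : ℕ+) : ℕ) - 1 = ((m : ℕ) - 1) + 1 := by
        have := m.pos
        rw [PNat.add_coe, PNat.one_coe]
        omega
      rcases ht : t.reverse with _ | ⟨n, s⟩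
      · simp only [ht, ellRev, hm, Function.iterate_succ_apply', List.reverse_append, List.dropLast_concat, List.getLast_concat, List.concat_eq_append, List.head_cons, List.tail_cons, List.reverse_cons, List.reverse_nil, List.nil_append, List.cons_append]
      · simp only [ht, ellRev, hm, Function.iterate_succ_apply', List.reverse_append, List.dropLast_concat, List.getLast_concat, List.concat_eq_append, List.head_cons, List.tail_cons, List.reverse_cons, List.reverse_nil, List.nil_append, List.cons_append]
  exact e

theorem ell_succ_P (α : AP K) : ell (succ α (P [1])) = pos (ell α) * L := by
  have h1 : ell α * L = pos (ell α) * L + neg (ell α) * L := by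
    conv_lhs => rw [← pos_add_neg (ell α)]
    exact (mulL (K := K)).map_add _ _
  simp only [succ, LinearMap.add_apply, map_add]
  rw [ell_prec_P, ell_bullet_P, h1]
  abel

theorem r_P_prec (α : AP K) : r (prec (P [1]) α) = -(L * pos (r α)) := by
  suffices h : r ∘ₗ (prec (P [1])) = -(Lmul ∘ₗ pos ∘ₗ (r (K := K))) from
    congrArg (fun φ => φ α) h
  apply Finsupp.lhom_ext'
  intro u
  ext1
  obtain ⟨w, hw⟩ := u
  have e : r (prec (P [1]) (Finsupp.single ⟨w, hw⟩ (1 : K)))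
      = -(L * pos (r (Finsupp.single ⟨w, hw⟩ (1 : K)))) := by
    rw [P_ne (w := [1]) (by simp), prec, bilin_single, P_ne (by simp), r_single, r_single]
    obtain ⟨n, t, rfl⟩ := List.exists_cons_of_ne_nil hw
    simp [rWord]
  exact e

theorem r_P_bullet (α : AP K) : r (bullet (P [1]) α) = L * r α := by
  suffices h : r ∘ₗ (bullet (P [1])) = Lmul ∘ₗ (r (K := K)) from
    congrArg (fun φ => φ α) h
  apply Finsupp.lhom_ext'
  intro u
  ext1
  obtain ⟨w, hw⟩ := u
  have e : r (bullet (P [1]) (Finsupp.single ⟨w, hw⟩ (1 : K)))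
      = Lmul (r (Finsupp.single ⟨w, hw⟩ (1 : K))) := by
    rw [P_ne (w := [1]) (by simp), bullet, bilin_single, P_ne (by simp), r_single, r_single]
    obtain ⟨m, t, rfl⟩ := List.exists_cons_of_ne_nil hw
    have hm : ((1 + m : ℕ+) : ℕ) - 1 = ((m : ℕ) - 1) + 1 := by
      have := m.pos
      rw [PNat.add_coe, PNat.one_coe]
      omega
    rcases t with _ | ⟨n, s⟩
    · simp only [rWord, hm, Function.iterate_succ_apply', List.dropLast_singleton, List.getLast_singleton, List.head_cons, List.tail_cons, List.nil_append]
    · simp only [rWord, hm, Function.iterate_succ_apply', List.dropLast_singleton, List.getLast_singleton, List.head_cons, List.tail_cons, List.nil_append]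
  exact e

theorem r_P_succ (α : AP K) : r (succ (P [1]) α) = L * neg (r α) := by
  have h1 : L * r α = L * pos (r α) + L * neg (r α) := by
    conv_lhs => rw [← pos_add_neg (r α)]
    exact (Lmul (K := K)).map_add _ _
  simp only [succ, LinearMap.add_apply, map_add]
  rw [r_P_prec, r_P_bullet, h1]
  abel

/-! ## The generalized derivations -/

/-- The defining rules of the linear operators `δ_{m₁…m_k}` on `𝓡` (with `δ = id` for `k = 0`).
Here `ell (P w)` is `L^{m₁,…,m_k}` for `w = m₁…m_k`, and `w.take j`, `w.drop j` are `m₁…m_j`,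
`m_{j+1}…m_k`. -/
structure IsDelta (δ : List ℕ+ → RAlg K →ₗ[K] RAlg K) : Prop where
  nil : δ [] = LinearMap.id
  apply_L : ∀ w : List ℕ+, w ≠ [] →
    δ w L = -(neg (ell (P w)) * L - L * neg (ell (P w)))
      + ∑ j ∈ Finset.Ico 1 w.length, δ (w.take j) L * neg (ell (P (w.drop j)))
  apply_pos : ∀ (w : List ℕ+) (X : RAlg K), δ w (pos X) = pos (δ w X)
  apply_mul : ∀ (w : List ℕ+) (X Y : RAlg K),
    δ w (X * Y) = ∑ j ∈ Finset.range (w.length + 1), δ (w.take j) X * δ (w.drop j) Y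

end ellr

end

end NcKP

namespace NcKP

noncomputable section

/-! ## Associativity of the product of pseudo-differential operators -/

section PsiDORing

variable {K : Type*} [Field K]

open PsiDO

/-! Families of operators indexed by words are packaged as formal series in noncommuting variables
`t_m` that commute with `𝓡`. The Leibniz-type rule then says that `Δ(X) = ∑ (δ_w X) t_w` is
multiplicative, and the other rules say that it is compatible with the projection and prescribe
`Δ(L)`.

Put `N = 1 - ∑ ℓ(P_w)_{<0} t_w`, `E = 1 + ∑ ℓ(P_w)_{≥0} t_w`, `R = 1 - ∑ r(P_w)_{≥0} t_w`, `M = 1 +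
∑ r(P_w)_{<0} t_w` and `Λ = 1 + ∑ L^m t_m` (in the code `negEll`, `posEll`, `posR`, `negR`, `1 +
powL`). The recursions for `ℓ` and `r` become `E = N Λ` and `M = Λ R`. Hence `E R = N M`; the left
side has differential operators as coefficients, the right side is `1` plus terms of negative order,
so both equal `1` (`negEll_mul_negR`, `posEll_mul_posR`). The rule for `δ L` reads `Δ(L) N = N L`
(`apply_L_iff`), so `Δ(L^n) = N L^n M`; since `Λ` commutes with `L`, also `Δ(L^n) E = E L^n`.

On basis words the main product is the quasi-shuffle product (`Pcirc_P`). For a series `F` let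
`S_v(F)` have the coefficients `F(P_w ∘ P_v)`. Splitting off the last letter gives `S_{vb}(E) R -
S_{vb}(N) M = S_v(N) L^b M` (`stuffleSeries_ell_identity`). Induction on `v` now yields `Δ(N_v) =
S_v(N) M`: since `ℓ(P_{vb}) = N_v L^b`, its image under `Δ` is `S_v(N) M N L^b M = S_v(N) L^b M`,
and the negative part of the identity is the next case. Its coefficients are the formula for `ℓ`.
The formula for `r` is the mirror image, splitting off first letters.

Uniqueness holds because `Δ` is determined on `L` and fixes `∂⁻¹`, and these generate `𝓡`. For
existence, `u_{n+2}` is sent to the coefficients of `∂^{-n-1}` in `N L M`, extended to a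
homomorphism commuting with `∂ₓ`, and applied coefficientwise; this works because the nonconstant
terms of `N L M` have negative order. Everything rests on associativity of `∗`, which is proved
first. -/

theorem dx_one : dx K 1 = 0 := by simp [dx]

theorem dx_zsmul (c : ℤ) (f : DiffPoly K) : dx K (c • f) = c • dx K f := map_zsmul _ _ _

theorem finite_coeff_ne_zero (X Y : PsiDO K) (n : ℤ) :
    {p : ℤ × ℕ | coeff X p.1 ≠ 0 ∧ coeff Y (n + p.2 - p.1) ≠ 0}.Finite := by
  obtain ⟨N, hN⟩ := X.exists_bound
  obtain ⟨M, hM⟩ := Y.exists_bound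
  refine ((Set.finite_Icc (n - M) N).prod (Set.finite_Iic (N + M - n).toNat)).subset ?_
  rintro p ⟨h1, h2⟩
  have h1' := mt (hN p.1) h1
  have h2' := mt (hM (n + p.2 - p.1)) h2
  simp only [Set.mem_prod, Set.mem_Icc, Set.mem_Iic]
  omega

theorem finite_support_of_coeff (X Y : PsiDO K) (n : ℤ) (f : ℤ × ℕ → DiffPoly K)
    (hX : ∀ p, coeff X p.1 = 0 → f p = 0)
    (hY : ∀ p : ℤ × ℕ, coeff Y (n + p.2 - p.1) = 0 → f p = 0) :
    (Function.support f).Finite :=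
  (finite_coeff_ne_zero X Y n).subset fun p hp => ⟨mt (hX p) hp, mt (hY p) hp⟩

theorem coeff_mul_eq_zero {X Y : PsiDO K} {N M : ℤ} (hX : ∀ i, N < i → coeff X i = 0)
    (hY : ∀ i, M < i → coeff Y i = 0) {n : ℤ} (h : N + M < n) : coeff (X * Y) n = 0 := by
  rw [coeff_mul, ← finsum_zero (α := ℤ × ℕ)]
  exact finsum_congr fun p => mulTerm_eq_zero hX hY n p (by omega)

/-- The operator `f ∂^i`. -/
def mono (f : DiffPoly K) (i : ℤ) : PsiDO K :=
  ofFun (fun j => if j = i then f else 0) ⟨i, fun j hj => if_neg (by omega)⟩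

theorem coeff_mono (f : DiffPoly K) (i j : ℤ) :
    coeff (mono f i) j = if j = i then f else 0 := rfl

theorem dinv_eq_mono : PsiDO.dinv K = mono 1 (-1) := rfl

theorem coeff_mono_zero_mul (f : DiffPoly K) (Y : PsiDO K) (n : ℤ) :
    coeff (mono f 0 * Y) n = f * coeff Y n := by
  rw [coeff_mul, finsum_eq_single _ (0, 0)]
  · simp [mulTerm, coeff_mono]
  · rintro ⟨i, l⟩ h
    by_cases hi : i = 0
    · subst hi
      rcases l with _ | l
      · exact absurd rfl h
      · simp [mulTerm, Ring.choose_zero_succ]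
    · simp [mulTerm, coeff_mono, hi]

theorem coeff_mul_mono_one_zero (X : PsiDO K) (n : ℤ) :
    coeff (X * mono 1 0) n = coeff X n := by
  rw [coeff_mul, finsum_eq_single _ (n, 0)]
  · simp [mulTerm, coeff_mono]
  · rintro ⟨i, l⟩ h
    rcases l with _ | l
    · have : ¬ n - i = 0 := fun h' => h (by simp; omega)
      simp [mulTerm, coeff_mono, this]
    · have : (dx K)^[l + 1] (if n + (l + 1 : ℕ) - i = 0 then 1 else 0) = 0 := by
        rw [Function.iterate_succ_apply]
        split_ifs <;> simp [dx_one]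
      simp only [mulTerm, coeff_mono]
      rw [this]
      simp

theorem coeff_mono_one_one_mul (Y : PsiDO K) (n : ℤ) :
    coeff (mono 1 1 * Y) n = coeff Y (n - 1) + dx K (coeff Y n) := by
  have hs : Function.support (mulTerm (coeff (mono (1 : DiffPoly K) 1)) (coeff Y) n)
      ⊆ (({(1, 0), (1, 1)} : Finset (ℤ × ℕ)) : Set (ℤ × ℕ)) := by
    rintro ⟨i, l⟩ h
    by_contra hp
    apply h
    by_cases hi : i = 1
    · subst hi
      rcases l with _ | _ | l
      · simp at hp
      · simp at hp
      · have : Ring.choose (1 : ℤ) (l + 1 + 1) = 0 := by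
          have := Ring.choose_natCast (R := ℤ) 1 (l + 1 + 1)
          rw [Nat.cast_one] at this
          rw [this, Nat.choose_eq_zero_of_lt (by omega), Nat.cast_zero]
        simp [mulTerm, this]
    · simp [mulTerm, coeff_mono, hi]
  rw [coeff_mul, finsum_eq_sum_of_support_subset _ hs, Finset.sum_pair (by simp)]
  simp [mulTerm, coeff_mono]

/-- Pascal's rule for integer upper index, after shifting `i` on the left and `l` in the last sum.
It is the binomial content of associativity with left factor `∂`. -/
theorem finsum_pascal (Y Z : PsiDO K) (n : ℤ) :
    ∑ᶠ p : ℤ × ℕ, Ring.choose p.1 p.2 • (coeff Y (p.1 - 1) * (dx K)^[p.2] (coeff Z (n + p.2 - p.1)))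
      = ∑ᶠ p : ℤ × ℕ, mulTerm (coeff Y) (coeff Z) (n - 1) p
        + ∑ᶠ p : ℤ × ℕ, Ring.choose p.1 p.2 •
            (coeff Y p.1 * (dx K)^[p.2 + 1] (coeff Z (n + p.2 - p.1))) := by
  -- The value at `(i, l)` is `i` choose `l - 1`, read as `0` for `l = 0`.
  let c : ℤ × ℕ → ℤ := fun p => Nat.casesOn p.2 0 fun l => Ring.choose p.1 l
  let T : ℤ × ℕ → DiffPoly K := fun p =>
    coeff Y p.1 * (dx K)^[p.2] (coeff Z (n - 1 + p.2 - p.1))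
  have h1 : ∑ᶠ p : ℤ × ℕ, Ring.choose p.1 p.2 •
      (coeff Y (p.1 - 1) * (dx K)^[p.2] (coeff Z (n + p.2 - p.1)))
      = ∑ᶠ p : ℤ × ℕ, Ring.choose (p.1 + 1) p.2 • T p := by
    rw [← finsum_comp_equiv ((Equiv.addRight (1 : ℤ)).prodCongr (Equiv.refl ℕ))]
    refine finsum_congr fun p => ?_
    have : n + (p.2 : ℤ) - (p.1 + 1) = n - 1 + p.2 - p.1 := by ring
    simp [T, this]
  have hg : Function.Injective fun p : ℤ × ℕ => (p.1, p.2 + 1) := by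
    rintro ⟨a, b⟩ ⟨a', b'⟩ h
    simpa using h
  have h2 : ∑ᶠ p : ℤ × ℕ, Ring.choose p.1 p.2 •
      (coeff Y p.1 * (dx K)^[p.2 + 1] (coeff Z (n + p.2 - p.1))) = ∑ᶠ p : ℤ × ℕ, c p • T p := by
    rw [← finsum_mem_univ fun p : ℤ × ℕ => c p • T p,
      ← finsum_mem_inter_support_eq (fun p : ℤ × ℕ => c p • T p)
        (Set.range fun p : ℤ × ℕ => (p.1, p.2 + 1)) Set.univ, finsum_mem_range hg]
    · refine finsum_congr fun p => ?_
      have : n - 1 + ((p.2 + 1 : ℕ) : ℤ) - p.1 = n + p.2 - p.1 := by push_cast; ring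
      simp only [c, T, this]
    · ext ⟨i, l⟩
      rcases l with _ | l
      · simp [c]
      · simp
  have hT1 : ∀ p, coeff Y p.1 = 0 → T p = 0 := fun p h => by simp [T, h]
  have hT2 : ∀ p : ℤ × ℕ, coeff Z (n - 1 + p.2 - p.1) = 0 → T p = 0 := fun p h => by
    simp [T, h]
  rw [h1, h2, ← finsum_add_distrib (mulTerm_finite Y Z (n - 1))
    (finite_support_of_coeff Y Z (n - 1) _ (fun p h => by simp [hT1 p h])
      fun p h => by simp [hT2 p h])]
  refine finsum_congr fun p => ?_
  obtain ⟨i, l⟩ := p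
  have : Ring.choose (i + 1) l = Ring.choose i l + c (i, l) := by
    rcases l with _ | l
    · simp [c]
    · rw [Ring.choose_succ_succ, add_comm]
  change Ring.choose (i + 1) l • T (i, l) = Ring.choose i l • T (i, l) + c (i, l) • T (i, l)
  rw [this, add_smul]

theorem map_dx_finsum {ι : Type*} (f : ι → DiffPoly K) (hf : (Function.support f).Finite) :
    dx K (∑ᶠ p, f p) = ∑ᶠ p, dx K (f p) :=
  (dx K).toAddMonoidHom.map_finsum hf

theorem mono_one_one_mul_assoc (Y Z : PsiDO K) :
    mono 1 1 * (Y * Z) = (mono 1 1 * Y) * Z := by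
  apply PsiDO.ext
  intro n
  rw [coeff_mono_one_one_mul, coeff_mul, coeff_mul, coeff_mul,
    map_dx_finsum _ (mulTerm_finite Y Z n)]
  have e1 : ∀ p, dx K (mulTerm (coeff Y) (coeff Z) n p) =
      Ring.choose p.1 p.2 • (dx K (coeff Y p.1) * (dx K)^[p.2] (coeff Z (n + p.2 - p.1)))
      + Ring.choose p.1 p.2 • (coeff Y p.1 * (dx K)^[p.2 + 1] (coeff Z (n + p.2 - p.1))) := by
    intro p
    rw [mulTerm, dx_zsmul, dx_mul, smul_add, Function.iterate_succ_apply']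
  have e2 : ∀ p, mulTerm (coeff (mono 1 1 * Y)) (coeff Z) n p =
      Ring.choose p.1 p.2 • (coeff Y (p.1 - 1) * (dx K)^[p.2] (coeff Z (n + p.2 - p.1)))
      + Ring.choose p.1 p.2 • (dx K (coeff Y p.1) * (dx K)^[p.2] (coeff Z (n + p.2 - p.1))) := by
    intro p
    rw [mulTerm, coeff_mono_one_one_mul, _root_.add_mul, smul_add]
  have f1 := finite_support_of_coeff Y Z n (fun p => Ring.choose p.1 p.2 •
    (dx K (coeff Y p.1) * (dx K)^[p.2] (coeff Z (n + p.2 - p.1))))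
    (fun p h => by simp [h]) (fun p h => by simp [h])
  have f2 := finite_support_of_coeff Y Z n (fun p => Ring.choose p.1 p.2 •
    (coeff Y p.1 * (dx K)^[p.2 + 1] (coeff Z (n + p.2 - p.1))))
    (fun p h => by simp [h]) (fun p h => by simp [h])
  have f3 : (Function.support fun p : ℤ × ℕ => Ring.choose p.1 p.2 •
      (coeff Y (p.1 - 1) * (dx K)^[p.2] (coeff Z (n + p.2 - p.1)))).Finite := by
    refine ((finite_coeff_ne_zero Y Z (n - 1)).image
      fun p : ℤ × ℕ => (p.1 + 1, p.2)).subset fun p hp => ⟨(p.1 - 1, p.2), ⟨?_, ?_⟩, by simp⟩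
    · exact mt (fun h => by simp [h]) hp
    · have e : n - 1 + (p.2 : ℤ) - (p.1 - 1) = n + p.2 - p.1 := by ring
      refine mt (fun h => ?_) hp
      rw [e] at h
      simp [h]
  rw [finsum_congr e1, finsum_congr e2, finsum_add_distrib f1 f2, finsum_add_distrib f3 f1,
    finsum_pascal]
  abel

/-- The coefficient of `∂^{i+1}` in `∂ ∗ X` is `X_i + ∂ₓ X_{i+1}`, so the coefficients are recovered
downwards from a common bound. -/
theorem eq_of_mono_one_one_mul {X Y : PsiDO K} (h : mono 1 1 * X = mono 1 1 * Y) : X = Y := by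
  obtain ⟨N, hN⟩ := X.exists_bound
  obtain ⟨M, hM⟩ := Y.exists_bound
  have key : ∀ k : ℕ, ∀ i, max N M - k < i → coeff X i = coeff Y i := by
    intro k
    induction k with
    | zero =>
      intro i hi
      rw [hN i (by have := le_max_left N M; omega), hM i (by have := le_max_right N M; omega)]
    | succ k ih =>
      intro i hi
      have h1 := congrArg (fun Z => coeff Z (i + 1)) h
      simp only [coeff_mono_one_one_mul] at h1
      rw [ih (i + 1) (by push_cast at hi; omega), add_sub_cancel_right] at h1
      exact add_right_cancel h1
  exact PsiDO.ext fun i => key (max N M - i + 1).toNat i (by omega)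

/-- `X` associates with all pairs of operators to its right. -/
def LeftAssoc (X : PsiDO K) : Prop := ∀ Y Z : PsiDO K, X * (Y * Z) = (X * Y) * Z

theorem LeftAssoc.mul {X Y : PsiDO K} (hX : LeftAssoc X) (hY : LeftAssoc Y) :
    LeftAssoc (X * Y) := fun Z W => by
  rw [← hX, hY, hX, hX]

theorem LeftAssoc.add {X Y : PsiDO K} (hX : LeftAssoc X) (hY : LeftAssoc Y) :
    LeftAssoc (X + Y) := fun Z W => by
  rw [PsiDO.add_mul, hX, hY, PsiDO.add_mul, PsiDO.add_mul]

/-! ### Powers of `∂` as left factors, and full associativity -/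

theorem mono_one_one_mul_mono (i : ℤ) : mono (1 : DiffPoly K) 1 * mono 1 i = mono 1 (i + 1) := by
  apply PsiDO.ext
  intro n
  rw [coeff_mono_one_one_mul, coeff_mono, coeff_mono, coeff_mono]
  have : dx K (if n = i then 1 else 0) = 0 := by split_ifs <;> simp [dx_one]
  rw [this, add_zero]
  exact if_congr (by omega) rfl rfl

theorem mono_zero_mul_mono (f : DiffPoly K) (i : ℤ) : mono f 0 * mono 1 i = mono f i := by
  apply PsiDO.ext
  intro n
  rw [coeff_mono_zero_mul, coeff_mono, coeff_mono]
  split_ifs <;> simp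

theorem mono_one_zero_mul (X : PsiDO K) : mono 1 0 * X = X :=
  PsiDO.ext fun n => by rw [coeff_mono_zero_mul, one_mul]

theorem mul_mono_one_zero (X : PsiDO K) : X * mono 1 0 = X :=
  PsiDO.ext fun n => coeff_mul_mono_one_zero X n

theorem mono_one_one_mul_neg_one_mul (X : PsiDO K) : mono 1 1 * (mono 1 (-1) * X) = X := by
  rw [mono_one_one_mul_assoc, mono_one_one_mul_mono, neg_add_cancel, mono_one_zero_mul]

theorem mono_neg_one_mul_mono (i : ℤ) :
    mono (1 : DiffPoly K) (-1) * mono 1 i = mono 1 (i - 1) := by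
  apply eq_of_mono_one_one_mul
  rw [mono_one_one_mul_neg_one_mul, mono_one_one_mul_mono, sub_add_cancel]

theorem leftAssoc_mono_zero (f : DiffPoly K) : LeftAssoc (mono f 0) := fun Y Z => by
  apply PsiDO.ext
  intro n
  rw [coeff_mono_zero_mul, coeff_mul, coeff_mul]
  rw [show f * ∑ᶠ p, mulTerm (coeff Y) (coeff Z) n p
      = ∑ᶠ p, f * mulTerm (coeff Y) (coeff Z) n p from
    (AddMonoidHom.mulLeft f).map_finsum (mulTerm_finite Y Z n)]
  refine finsum_congr fun p => ?_
  rw [mulTerm, mulTerm, coeff_mono_zero_mul, mul_smul_comm, mul_assoc]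

/-- After multiplying by `∂` on the left, which is injective and already known to associate, both
sides become `Y * Z`. -/
theorem leftAssoc_mono_neg_one : LeftAssoc (mono (1 : DiffPoly K) (-1)) := fun Y Z => by
  apply eq_of_mono_one_one_mul
  rw [mono_one_one_mul_neg_one_mul, mono_one_one_mul_assoc, mono_one_one_mul_neg_one_mul]

theorem leftAssoc_mono_one (i : ℤ) : LeftAssoc (mono (1 : DiffPoly K) i) := by
  induction i using Int.induction_on with
  | zero => exact leftAssoc_mono_zero 1
  | succ i ih =>
    rw [← mono_one_one_mul_mono]
    exact LeftAssoc.mul mono_one_one_mul_assoc ih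
  | pred i ih =>
    rw [← mono_neg_one_mul_mono]
    exact leftAssoc_mono_neg_one.mul ih

theorem leftAssoc_mono (f : DiffPoly K) (i : ℤ) : LeftAssoc (mono f i) := by
  rw [← mono_zero_mul_mono]
  exact (leftAssoc_mono_zero f).mul (leftAssoc_mono_one i)

/-- Induction on the width of the window of possibly nonzero coefficients, removing the top
monomial. -/
theorem leftAssoc_of_finite (M : ℤ) (k : ℕ) : ∀ X : PsiDO K,
    (∀ i, i ≤ M → coeff X i = 0) → (∀ i, M + k < i → coeff X i = 0) → LeftAssoc X := by
  induction k with
  | zero =>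
    intro X h1 h2
    have : X = mono 0 0 := PsiDO.ext fun i => by
      rw [coeff_mono, ite_self]
      rcases le_or_gt i M with h | h
      · exact h1 i h
      · exact h2 i (by simpa using h)
    rw [this]
    exact leftAssoc_mono 0 0
  | succ k ih =>
    intro X h1 h2
    have : X = (X - mono (coeff X (M + k + 1)) (M + k + 1))
        + mono (coeff X (M + k + 1)) (M + k + 1) := (sub_add_cancel _ _).symm
    rw [this]
    refine LeftAssoc.add (ih _ (fun i hi => ?_) fun i hi => ?_) (leftAssoc_mono _ _)
    · rw [map_sub, Pi.sub_apply, h1 i hi, coeff_mono, if_neg (by omega), sub_zero]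
    · rw [map_sub, Pi.sub_apply, coeff_mono]
      split_ifs with h
      · rw [h, sub_self]
      · rw [h2 i (by push_cast; omega), sub_zero]

theorem leftAssoc (X : PsiDO K) : LeftAssoc X := fun Y Z => by
  apply PsiDO.ext
  intro n
  obtain ⟨A, hA⟩ := X.exists_bound
  obtain ⟨B, hB⟩ := Y.exists_bound
  obtain ⟨C, hC⟩ := Z.exists_bound
  -- The part of `X` of order at most `M` contributes to the triple products only in orders at most
  -- `n - 1`, so it is invisible at `∂^n`; the rest of `X` is a finite sum of monomials.
  let M : ℤ := n - 1 - B - C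
  let X₁ : PsiDO K := ofFun (fun i => if i ≤ M then 0 else coeff X i)
    ⟨A, fun i hi => by simp [hA i hi]⟩
  let X₂ : PsiDO K := ofFun (fun i => if i ≤ M then coeff X i else 0)
    ⟨M, fun i hi => by rw [if_neg (by omega)]⟩
  have hX : X = X₁ + X₂ := PsiDO.ext fun i => by
    rw [map_add, Pi.add_apply]
    by_cases h : i ≤ M <;> simp [X₁, X₂, h]
  have h1 : LeftAssoc X₁ := by
    refine leftAssoc_of_finite M (A - M).toNat X₁ (fun i hi => ?_) fun i hi => ?_
    · simp [X₁, hi]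
    · simp [X₁, hA i (by omega)]
  have h2 : ∀ i, M < i → coeff X₂ i = 0 := fun i hi => by
    simp only [X₂, coeff_ofFun]
    rw [if_neg (by omega)]
  have hYZ : ∀ i, B + C < i → coeff (Y * Z) i = 0 := fun i hi => coeff_mul_eq_zero hB hC hi
  have hXY : ∀ i, M + B < i → coeff (X₂ * Y) i = 0 := fun i hi => coeff_mul_eq_zero h2 hB hi
  rw [hX, PsiDO.add_mul, PsiDO.add_mul, PsiDO.add_mul, h1, map_add, map_add, Pi.add_apply,
    Pi.add_apply, coeff_mul_eq_zero h2 hYZ (by omega), coeff_mul_eq_zero hXY hC (by omega)]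

/-! ## The ring `𝓡` -/

theorem generated_one : Generated K (mono 1 0) := by
  have h : mono 1 0 = PsiDO.nonneg (PsiDO.L K) * PsiDO.dinv K := by
    have : PsiDO.nonneg (PsiDO.L K) = mono 1 1 := PsiDO.ext fun i => by
      rw [coeff_nonneg, coeff_mono]
      simp only [PsiDO.L, coeff_ofFun]
      split_ifs <;> first | rfl | omega
    rw [this, dinv_eq_mono, mono_one_one_mul_mono]
    rfl
  rw [h]
  exact (Generated.L.nonneg).mul Generated.dinv

scoped instance : Ring (RAlg K) :=
  { (inferInstance : AddCommGroup (RAlg K)), (inferInstance : Mul (RAlg K)) with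
    one := ⟨mono 1 0, generated_one⟩
    one_mul := fun X => Subtype.ext (mono_one_zero_mul X.1)
    mul_one := fun X => Subtype.ext (mul_mono_one_zero X.1)
    mul_assoc := fun X Y Z => Subtype.ext (leftAssoc X.1 Y.1 Z.1).symm
    left_distrib := fun X Y Z => Subtype.ext (PsiDO.mul_add X.1 Y.1 Z.1)
    right_distrib := fun X Y Z => Subtype.ext (PsiDO.add_mul X.1 Y.1 Z.1)
    zero_mul := fun X => Subtype.ext (by
      have := PsiDO.smul_mul (0 : K) 0 X.1
      rwa [zero_smul, zero_smul] at this)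
    mul_zero := fun X => Subtype.ext (by
      have := PsiDO.mul_smul (0 : K) X.1 0
      rwa [zero_smul, zero_smul] at this) }

scoped instance : Algebra K (RAlg K) :=
  Algebra.ofModule (fun c X Y => Subtype.ext (PsiDO.smul_mul c X.1 Y.1))
    (fun c X Y => Subtype.ext (PsiDO.mul_smul c X.1 Y.1))

end PsiDORing

/-! ## Noncommutative formal series -/

/-- Noncommutative formal power series in `t₁, t₂, …` with coefficients in `A`, given by the
coefficients of the words in the variables, which commute with `A`. -/
def WordSeries (A : Type*) : Type _ := List ℕ+ → A

namespace WordSeries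

variable {A : Type*}

instance [AddCommGroup A] : AddCommGroup (WordSeries A) :=
  inferInstanceAs (AddCommGroup (List ℕ+ → A))

theorem add_apply [AddCommGroup A] (f g : WordSeries A) (w : List ℕ+) :
    (f + g) w = f w + g w := rfl

theorem sub_apply [AddCommGroup A] (f g : WordSeries A) (w : List ℕ+) :
    (f - g) w = f w - g w := rfl

theorem zero_apply [AddCommGroup A] (w : List ℕ+) : (0 : WordSeries A) w = 0 := rfl

variable [Ring A]

instance : Mul (WordSeries A) :=
  ⟨fun f g w => ∑ j ∈ Finset.range (w.length + 1), f (w.take j) * g (w.drop j)⟩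

theorem mul_apply (f g : WordSeries A) (w : List ℕ+) :
    (f * g) w = ∑ j ∈ Finset.range (w.length + 1), f (w.take j) * g (w.drop j) := rfl

/-- The series whose only term is the constant term `a`. -/
def const (a : A) : WordSeries A := fun w => if w = [] then a else 0

instance : One (WordSeries A) := ⟨const 1⟩

theorem one_eq : (1 : WordSeries A) = const 1 := rfl

theorem const_nil (a : A) : const a [] = a := rfl

theorem const_of_ne (a : A) {w : List ℕ+} (h : w ≠ []) : const a w = 0 := if_neg h

theorem one_nil : (1 : WordSeries A) [] = 1 := rfl

theorem one_of_ne {w : List ℕ+} (h : w ≠ []) : (1 : WordSeries A) w = 0 := if_neg h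

/-- The series `f` with the letter `a` removed from the front of its words. -/
def tail (f : WordSeries A) (a : ℕ+) : WordSeries A := fun w => f (a :: w)

theorem mul_nil (f g : WordSeries A) : (f * g) [] = f [] * g [] := by simp [mul_apply]

theorem mul_cons (f g : WordSeries A) (a : ℕ+) (w : List ℕ+) :
    (f * g) (a :: w) = f [] * g (a :: w) + (f.tail a * g) w := by
  rw [mul_apply, Finset.sum_range_succ', add_comm]
  simp [mul_apply, tail]

theorem const_mul_apply (a : A) (f : WordSeries A) (w : List ℕ+) :
    (const a * f) w = a * f w := by
  rw [mul_apply, Finset.sum_eq_single 0]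
  · simp [const_nil]
  · intro j hj h0
    rw [Finset.mem_range] at hj
    rw [const_of_ne, zero_mul]
    intro h
    have := congrArg List.length h
    rw [List.length_take, List.length_nil] at this
    omega
  · simp

theorem mul_assoc' (f g h : WordSeries A) : f * g * h = f * (g * h) := by
  funext w
  induction w generalizing f g h with
  | nil => simp [mul_nil, mul_assoc]
  | cons a w ih =>
    have e : (f * g).tail a = const (f []) * g.tail a + f.tail a * g := funext fun w => by
      rw [add_apply, const_mul_apply]
      exact mul_cons f g a w
    have e' : ∀ (c : A) (k : WordSeries A), (const c * k * h) w = c * (k * h) w := fun c k => by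
      rw [mul_apply, mul_apply, Finset.mul_sum]
      simp only [const_mul_apply, mul_assoc]
    have e'' : ∀ x y : WordSeries A, ((x + y) * h) w = (x * h) w + (y * h) w := fun x y => by
      simp [mul_apply, add_apply, add_mul, Finset.sum_add_distrib]
    rw [mul_cons, mul_cons, mul_cons, mul_nil, e, e'', e', ih, mul_add, mul_assoc, add_assoc]

theorem mul_const_apply (a : A) (f : WordSeries A) (w : List ℕ+) :
    (f * const a) w = f w * a := by
  rw [mul_apply, Finset.sum_eq_single w.length]
  · simp [const_nil]
  · intro j hj h0
    rw [Finset.mem_range] at hj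
    rw [const_of_ne, mul_zero]
    intro h
    have := congrArg List.length h
    rw [List.length_drop, List.length_nil] at this
    omega
  · simp

instance : Ring (WordSeries A) :=
  { (inferInstance : AddCommGroup (WordSeries A)), (inferInstance : Mul (WordSeries A)),
    (inferInstance : One (WordSeries A)) with
    one_mul := fun f => funext fun w => by rw [one_eq, const_mul_apply, one_mul]
    mul_one := fun f => funext fun w => by rw [one_eq, mul_const_apply, mul_one]
    mul_assoc := mul_assoc'
    left_distrib := fun f g h => funext fun w => by
      simp [mul_apply, add_apply, mul_add, Finset.sum_add_distrib]
    right_distrib := fun f g h => funext fun w => by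
      simp [mul_apply, add_apply, add_mul, Finset.sum_add_distrib]
    zero_mul := fun f => funext fun w => by simp [mul_apply, zero_apply]
    mul_zero := fun f => funext fun w => by simp [mul_apply, zero_apply] }

instance {K : Type*} [Field K] [Algebra K A] : Module K (WordSeries A) :=
  inferInstanceAs (Module K (List ℕ+ → A))

theorem smul_apply {K : Type*} [Field K] [Algebra K A] (c : K) (f : WordSeries A)
    (w : List ℕ+) : (c • f) w = c • f w := rfl

instance {K : Type*} [Field K] [Algebra K A] : Algebra K (WordSeries A) :=
  Algebra.ofModule
    (fun c f g => funext fun w => by simp [mul_apply, smul_apply, Finset.smul_sum])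
    (fun c f g => funext fun w => by simp [mul_apply, smul_apply, Finset.smul_sum])

theorem const_mul_const (a b : A) : const a * const b = const (a * b) := funext fun w => by
  rw [const_mul_apply]
  by_cases h : w = []
  · simp [h, const_nil]
  · rw [const_of_ne _ h, const_of_ne _ h, mul_zero]

/-- The outer terms of a coefficient of a product. -/
theorem mul_apply_of_ne (f g : WordSeries A) {w : List ℕ+} (h : w ≠ []) :
    (f * g) w = f [] * g w + ∑ j ∈ Finset.Ico 1 w.length, f (w.take j) * g (w.drop j)
      + f w * g [] := by
  have hk : 0 < w.length := List.length_pos_iff.2 h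
  rw [mul_apply, Finset.sum_range_succ, Finset.range_eq_Ico, Finset.sum_eq_sum_Ico_succ_bot hk]
  simp

/-- By induction on word length: once `g` vanishes on shorter words, the coefficient of `f * g` at
`w` is `f [] * g w = g w`. -/
theorem eq_zero_of_mul_eq_zero {f g : WordSeries A} (hf : f [] = 1) (h : f * g = 0) : g = 0 := by
  have key : ∀ n : ℕ, ∀ w : List ℕ+, w.length = n → g w = 0 := by
    intro n
    induction n using Nat.strong_induction_on with
    | _ n ih =>
      intro w hw
      have h1 : (f * g) w = 0 := by rw [h, zero_apply]
      rw [mul_apply, Finset.sum_eq_single 0] at h1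
      · simpa [hf] using h1
      · intro j hj h0
        rw [Finset.mem_range] at hj
        rw [ih (w.length - j) (by omega) (w.drop j) (by simp), mul_zero]
      · simp
  exact funext fun w => key _ w rfl

theorem mul_eq_one_comm_of_nil {f g : WordSeries A} (hf : f [] = 1) (h : f * g = 1) :
    g * f = 1 := by
  rw [← sub_eq_zero]
  apply eq_zero_of_mul_eq_zero hf
  rw [mul_sub, ← mul_assoc, h, one_mul, mul_one, sub_self]

end WordSeries

/-! ## The main product as a quasi-shuffle product -/

section Stuffle

variable {A : Type*} [AddCommGroup A]

/-- The sum of the values of `F` at the quasi-shuffles of two words. -/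
def stuffle : (List ℕ+ → A) → List ℕ+ → List ℕ+ → A
  | F, [], v => F v
  | F, a :: u, [] => F (a :: u)
  | F, a :: u, b :: v =>
    stuffle (fun x => F (a :: x)) u (b :: v) + stuffle (fun x => F (b :: x)) (a :: u) v
      + stuffle (fun x => F ((a + b) :: x)) u v
termination_by _ u v => u.length + v.length

theorem stuffle_nil_left (F : List ℕ+ → A) (v : List ℕ+) : stuffle F [] v = F v := by
  rw [stuffle]

theorem stuffle_nil_right (F : List ℕ+ → A) (u : List ℕ+) : stuffle F u [] = F u := by
  cases u <;> rw [stuffle]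

theorem stuffle_cons_cons (F : List ℕ+ → A) (a b : ℕ+) (u v : List ℕ+) :
    stuffle F (a :: u) (b :: v) =
      stuffle (fun x => F (a :: x)) u (b :: v) + stuffle (fun x => F (b :: x)) (a :: u) v
      + stuffle (fun x => F ((a + b) :: x)) u v := by
  rw [stuffle]

/-- Quasi-shuffles are defined by their first letters, but `ℓ` recurses on the last letter; this is
the symmetric recursion from the right. -/
theorem stuffle_concat_concat (F : List ℕ+ → A) (a b : ℕ+) (u v : List ℕ+) :
    stuffle F (u ++ [a]) (v ++ [b]) =
      stuffle (fun x => F (x ++ [a])) u (v ++ [b]) + stuffle (fun x => F (x ++ [b])) (u ++ [a]) v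
      + stuffle (fun x => F (x ++ [a + b])) u v := by
  induction u generalizing F v with
  | nil =>
    induction v generalizing F with
    | nil => simp [stuffle_cons_cons, stuffle_nil_left, stuffle_nil_right, add_comm]
    | cons d v ihv =>
      have := ihv fun x => F (d :: x)
      simp only [List.nil_append, List.cons_append, stuffle_cons_cons, stuffle_nil_left] at this ⊢
      rw [this]
      abel
  | cons c u ihu =>
    induction v generalizing F with
    | nil =>
      have := ihu (fun x => F (c :: x)) []
      simp only [List.nil_append, List.cons_append, stuffle_cons_cons, stuffle_nil_right] at this ⊢
      rw [this]
      abel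
    | cons d v ihv =>
      have h1 := ihu (fun x => F (c :: x)) (d :: v)
      have h2 := ihv fun x => F (d :: x)
      have h3 := ihu (fun x => F ((c + d) :: x)) v
      simp only [List.cons_append] at h1 h2 h3
      simp only [List.cons_append, stuffle_cons_cons]
      rw [h1, h2, h3]
      abel

theorem map_stuffle {B : Type*} [AddCommGroup B] (φ : A →+ B) (F : List ℕ+ → A) (u v : List ℕ+) :
    φ (stuffle F u v) = stuffle (fun x => φ (F x)) u v := by
  induction F, u, v using stuffle.induct with
  | case1 F v => simp [stuffle_nil_left]
  | case2 F a u => simp [stuffle_nil_right]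
  | case3 F a u b v h1 h2 h3 => rw [stuffle_cons_cons, stuffle_cons_cons, map_add, map_add, h1, h2, h3]

theorem stuffle_add (F G : List ℕ+ → A) (u v : List ℕ+) :
    stuffle (fun x => F x + G x) u v = stuffle F u v + stuffle G u v := by
  induction F, u, v using stuffle.induct generalizing G with
  | case1 F v => simp [stuffle_nil_left]
  | case2 F a u => simp [stuffle_nil_right]
  | case3 F a u b v h1 h2 h3 =>
    rw [stuffle_cons_cons, stuffle_cons_cons, stuffle_cons_cons, h1, h2, h3]
    abel

/-- Quasi-shuffles with a nonempty word are nonempty, so the value at `[]` is irrelevant. This lets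
series with constant term `1` be compared with projections of `ℓ` and `r`, whose value at `[]` is
`0`. -/
theorem stuffle_congr {F G : List ℕ+ → A} (h : ∀ x, x ≠ [] → F x = G x) (u : List ℕ+)
    {v : List ℕ+} (hv : v ≠ []) : stuffle F u v = stuffle G u v := by
  obtain ⟨b, v, rfl⟩ := List.exists_cons_of_ne_nil hv
  rcases u with _ | ⟨a, u⟩
  · rw [stuffle_nil_left, stuffle_nil_left, h _ (by simp)]
  · have : ∀ c, (fun x => F (c :: x)) = fun x => G (c :: x) := fun c => funext fun x => h _ (by simp)
    rw [stuffle_cons_cons, stuffle_cons_cons, this, this, this]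

/-- The sum of the values of `F` at the words obtained from a shuffled deck by expanding
`≻ = ≺ + •`. -/
def deckSum : (List ℕ+ → A) → List (ℕ+ ⊕ ℕ+) → A
  | F, [] => F []
  | F, Sum.inl m :: Sum.inr n :: t =>
    deckSum (fun x => F (m :: x)) (Sum.inr n :: t) + deckSum (fun x => F ((m + n) :: x)) t
  | F, x :: t => deckSum (fun y => F (x.elim id id :: y)) t

theorem deckSum_inr (F : List ℕ+ → A) (n : ℕ+) (t : List (ℕ+ ⊕ ℕ+)) :
    deckSum F (Sum.inr n :: t) = deckSum (fun x => F (n :: x)) t := by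
  rw [deckSum]
  · rfl
  · simp

theorem deckSum_inl_inl (F : List ℕ+ → A) (m n : ℕ+) (t : List (ℕ+ ⊕ ℕ+)) :
    deckSum F (Sum.inl m :: Sum.inl n :: t)
      = deckSum (fun x => F (m :: x)) (Sum.inl n :: t) := by
  rw [deckSum]
  · rfl
  · simp

theorem deckSum_inl_inr (F : List ℕ+ → A) (m n : ℕ+) (t : List (ℕ+ ⊕ ℕ+)) :
    deckSum F (Sum.inl m :: Sum.inr n :: t) = deckSum (fun x => F (m :: x)) (Sum.inr n :: t)
      + deckSum (fun x => F ((m + n) :: x)) t := by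
  rw [deckSum]

theorem deckSum_map_inr (F : List ℕ+ → A) (v : List ℕ+) : deckSum F (v.map Sum.inr) = F v := by
  induction v generalizing F with
  | nil => simp [deckSum]
  | cons b v ih => rw [List.map_cons, deckSum_inr, ih]

theorem deckSum_map_inl (F : List ℕ+ → A) (u : List ℕ+) : deckSum F (u.map Sum.inl) = F u := by
  induction u generalizing F with
  | nil => simp [deckSum]
  | cons a u ih =>
    rcases u with _ | ⟨c, u⟩
    · simp [deckSum]
    · rw [List.map_cons, List.map_cons, deckSum_inl_inl, ← List.map_cons, ih]

theorem shuffles_cons_cons (a b : ℕ+) (u v : List ℕ+) :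
    shuffles (a :: u) (b :: v) =
      (shuffles u (b :: v)).map (Sum.inl a :: ·) ++ (shuffles (a :: u) v).map (Sum.inr b :: ·) := by
  rw [shuffles]

theorem shuffles_nil_left (v : List ℕ+) : shuffles [] v = [v.map Sum.inr] := by rw [shuffles]

theorem shuffles_nil_right (u : List ℕ+) : shuffles u [] = [u.map Sum.inl] := by
  cases u <;> rw [shuffles]
  · rfl
  · simp

/-- A card `a` of the first deck is followed by `≻` exactly when the next card is the top card `b`
of the second. The `•` part merges them into `a + b`, and what remains runs once through all
shuffles of `u` and `v`. -/
theorem sum_deckSum_inl_cons (F : List ℕ+ → A) (a b : ℕ+) (u v : List ℕ+) :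
    ((shuffles u (b :: v)).map fun s => deckSum F (Sum.inl a :: s)).sum =
      ((shuffles u (b :: v)).map fun s => deckSum (fun x => F (a :: x)) s).sum
      + ((shuffles u v).map fun s => deckSum (fun x => F ((a + b) :: x)) s).sum := by
  rcases u with _ | ⟨c, u⟩
  · simp [shuffles_nil_left, deckSum_inl_inr]
  · rw [shuffles_cons_cons]
    simp only [List.map_append, List.map_map, List.sum_append, Function.comp_def, deckSum_inl_inr,
      deckSum_inl_inl, List.sum_map_add]
    abel

theorem sum_deckSum_shuffles (F : List ℕ+ → A) (u v : List ℕ+) :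
    ((shuffles u v).map (deckSum F)).sum = stuffle F u v := by
  induction F, u, v using stuffle.induct with
  | case1 F v => simp [shuffles_nil_left, stuffle_nil_left, deckSum_map_inr]
  | case2 F a u => 
    rw [shuffles_nil_right, stuffle_nil_right, List.map_singleton, List.sum_singleton,
      deckSum_map_inl]
  | case3 F a u b v h1 h2 h3 =>
    rw [shuffles_cons_cons, stuffle_cons_cons, ← h1, ← h2, ← h3]
    simp only [List.map_append, List.map_map, List.sum_append, Function.comp_def, deckSum_inr,
      sum_deckSum_inl_cons]
    abel

theorem map_deckSum {B : Type*} [AddCommGroup B] (φ : A →+ B) (F : List ℕ+ → A)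
    (s : List (ℕ+ ⊕ ℕ+)) : φ (deckSum F s) = deckSum (fun x => φ (F x)) s := by
  induction F, s using deckSum.induct with
  | case1 F => simp [deckSum]
  | case2 F m n t h1 h2 => rw [deckSum_inl_inr, deckSum_inl_inr, map_add, h1, h2]
  | case3 F x t h ih => rw [deckSum, deckSum, ih] <;> exact h

theorem deckSum_congr {F G : List ℕ+ → A} (h : ∀ x, x ≠ [] → F x = G x)
    {s : List (ℕ+ ⊕ ℕ+)} (hs : s ≠ []) : deckSum F s = deckSum G s := by
  have e : ∀ c, (fun x => F (c :: x)) = fun x => G (c :: x) := fun c => funext fun x => h _ (by simp)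
  rcases s with _ | ⟨m | n, _ | ⟨m' | n', t⟩⟩
  · exact absurd rfl hs
  · simp [deckSum, h]
  · rw [deckSum_inl_inl, deckSum_inl_inl, e]
  · rw [deckSum_inl_inr, deckSum_inl_inr, e, e]
  · simp [deckSum, h]
  · rw [deckSum_inr F, deckSum_inr G, e]
  · rw [deckSum_inr F, deckSum_inr G, e]

end Stuffle

/-! ### The main product of basis words as a sum over quasi-shuffles -/

section Circ

variable {K : Type*} [Field K]

theorem prec_P (m : ℕ+) {x : List ℕ+} (hx : x ≠ []) : prec (P [m]) (P x : AP K) = P (m :: x) :=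
  (P_cons m hx).symm

theorem bullet_P (m n : ℕ+) (x : List ℕ+) :
    bullet (P [m]) (P (n :: x) : AP K) = P ((m + n) :: x) := by
  rw [P_ne (w := [m]) (by simp), P_ne (w := n :: x) (by simp), bullet, bilin_single]
  rfl

/-- The deck must be nonempty because of the dummy value `P [] = 0`, for which `prec_P` fails. -/
theorem prec_deckSum (m : ℕ+) {s : List (ℕ+ ⊕ ℕ+)} (hs : s ≠ []) :
    prec (P [m]) (deckSum P s : AP K) = deckSum (fun x => P (m :: x)) s :=
  (map_deckSum (prec (P [m]) : AP K →ₗ[K] AP K).toAddMonoidHom P s).trans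
    (deckSum_congr (fun _ hx => prec_P m hx) hs)

theorem bullet_deckSum (m n : ℕ+) (t : List (ℕ+ ⊕ ℕ+)) :
    bullet (P [m]) (deckSum P (Sum.inr n :: t) : AP K)
      = deckSum (fun x => P ((m + n) :: x)) t := by
  rw [deckSum_inr]
  refine (map_deckSum (bullet (P [m]) : AP K →ₗ[K] AP K).toAddMonoidHom _ t).trans ?_
  exact congrArg (fun F => deckSum F t) (funext fun x => bullet_P m n x)

theorem evalShuffle_eq_deckSum (s : List (ℕ+ ⊕ ℕ+)) (hs : s ≠ []) :
    (evalShuffle s : AP K) = deckSum P s := by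
  induction s with
  | nil => exact absurd rfl hs
  | cons x s ih =>
    rcases x with m | n <;> rcases s with _ | ⟨m' | n', t⟩
    · simp [evalShuffle, deckSum]
    · rw [evalShuffle, ih (by simp), deckSum_inl_inl, ← prec_deckSum m (by simp)]
      · rfl
      · simp
    · rw [evalShuffle, ih (by simp), deckSum_inl_inr, ← prec_deckSum m (by simp),
        ← bullet_deckSum]
      rfl
    · simp [evalShuffle, deckSum]
    · rw [evalShuffle, ih (by simp), deckSum_inr P n, ← prec_deckSum n (by simp)]
      · rfl
      · simp
    · rw [evalShuffle, ih (by simp), deckSum_inr P n, ← prec_deckSum n (by simp)]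
      · rfl
      · simp

theorem ne_nil_of_mem_shuffles {u v : List ℕ+} (hv : v ≠ []) {s : List (ℕ+ ⊕ ℕ+)}
    (hs : s ∈ shuffles u v) : s ≠ [] := by
  obtain ⟨b, v, rfl⟩ := List.exists_cons_of_ne_nil hv
  rcases u with _ | ⟨a, u⟩
  · simp only [shuffles_nil_left, List.mem_singleton] at hs
    simp [hs]
  · simp only [shuffles_cons_cons, List.mem_append, List.mem_map] at hs
    rcases hs with ⟨s, -, rfl⟩ | ⟨s, -, rfl⟩ <;> simp

theorem Pcirc_P (w : List ℕ+) {v : List ℕ+} (hv : v ≠ []) :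
    Pcirc w (P v : AP K) = stuffle P w v := by
  rw [Pcirc]
  split_ifs with hw
  · rw [hw, stuffle_nil_left]
  · rw [P_ne hw, P_ne hv, circ, bilin_single, ← sum_deckSum_shuffles]
    exact congrArg List.sum (List.map_congr_left fun s hs =>
      evalShuffle_eq_deckSum s (ne_nil_of_mem_shuffles hv hs))

end Circ

/-! ## The projections of `𝓡` -/

section Projections

variable {K : Type*} [Field K]

open PsiDO

theorem coeff_pos (X : RAlg K) (i : ℤ) :
    coeff (pos X).1 i = if 0 ≤ i then coeff X.1 i else 0 := rfl

theorem coeff_neg (X : RAlg K) (i : ℤ) :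
    coeff (neg X).1 i = if 0 ≤ i then 0 else coeff X.1 i := by
  have : coeff (neg X).1 i = coeff X.1 i - coeff (pos X).1 i := rfl
  rw [this, coeff_pos]
  split_ifs <;> simp

theorem RAlg.ext {X Y : RAlg K} (h : ∀ i, coeff X.1 i = coeff Y.1 i) : X = Y :=
  Subtype.ext (PsiDO.ext h)

theorem pos_eq_zero_iff {X : RAlg K} : pos X = 0 ↔ ∀ i, 0 ≤ i → coeff X.1 i = 0 := by
  constructor
  · intro h i hi
    have : coeff (pos X).1 i = 0 := by rw [h]; rfl
    rwa [coeff_pos, if_pos hi] at this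
  · intro h
    refine RAlg.ext fun i => ?_
    rw [coeff_pos]
    split_ifs with hi
    · exact h i hi
    · rfl

theorem neg_eq_zero_iff {X : RAlg K} : neg X = 0 ↔ ∀ i, i < 0 → coeff X.1 i = 0 := by
  constructor
  · intro h i hi
    have : coeff (neg X).1 i = 0 := by rw [h]; rfl
    rwa [coeff_neg, if_neg (by omega)] at this
  · intro h
    refine RAlg.ext fun i => ?_
    rw [coeff_neg]
    split_ifs with hi
    · rfl
    · exact h i (by omega)

theorem pos_neg (X : RAlg K) : pos (neg X) = 0 :=
  pos_eq_zero_iff.2 fun i hi => by rw [coeff_neg, if_pos hi]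

theorem neg_pos (X : RAlg K) : neg (pos X) = 0 :=
  neg_eq_zero_iff.2 fun i hi => by rw [coeff_pos, if_neg (by omega)]

theorem neg_eq_self {X : RAlg K} (h : pos X = 0) : neg X = X := by simp [neg, h]

theorem pos_eq_self {X : RAlg K} (h : neg X = 0) : pos X = X := by
  have := pos_add_neg X
  rwa [h, add_zero] at this

theorem pos_mul_eq_zero {X Y : RAlg K} (hX : pos X = 0) (hY : pos Y = 0) : pos (X * Y) = 0 := by
  rw [pos_eq_zero_iff] at *
  intro n hn
  exact coeff_mul_eq_zero (N := -1) (M := -1) (fun i hi => hX i (by omega))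
    (fun i hi => hY i (by omega)) (by omega)

theorem neg_mul_eq_zero {X Y : RAlg K} (hX : neg X = 0) (hY : neg Y = 0) : neg (X * Y) = 0 := by
  rw [neg_eq_zero_iff] at *
  intro n hn
  refine (coeff_mul X.1 Y.1 n).trans ?_
  rw [← finsum_zero (α := ℤ × ℕ)]
  refine finsum_congr fun p => ?_
  obtain ⟨i, l⟩ := p
  rcases lt_or_ge i 0 with hi | hi
  · simp [mulTerm, hX i hi]
  · rcases lt_or_ge (n + l - i) 0 with hj | hj
    · simp [mulTerm, hY _ hj]
    -- Here `n < 0 ≤ n + l - i` forces `l > i ≥ 0`: a differential operator acting on functions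
    -- creates no negative powers.
    · have : Ring.choose i l = 0 := by
        lift i to ℕ using hi
        have := Ring.choose_natCast (R := ℤ) i l
        rw [this, Nat.choose_eq_zero_of_lt (by omega), Nat.cast_zero]
      simp [mulTerm, this]

theorem neg_one_eq_zero : neg (1 : RAlg K) = 0 :=
  neg_eq_zero_iff.2 fun i hi => (coeff_mono 1 0 i).trans (if_neg (by omega))

theorem pos_L_val : (pos (L : RAlg K)).1 = mono 1 1 := PsiDO.ext fun i => by
  rw [coeff_pos, coeff_mono]
  simp only [L, PsiDO.L, coeff_ofFun]
  split_ifs <;> first | rfl | omega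

theorem coeff_mul_mono_one_one (X : PsiDO K) (n : ℤ) :
    coeff (X * mono 1 1) n = coeff X (n - 1) := by
  rw [coeff_mul, finsum_eq_single _ (n - 1, 0)]
  · simp [mulTerm, coeff_mono]
  · rintro ⟨i, l⟩ h
    rcases l with _ | l
    · have : ¬ n - i = 1 := fun h' => h (by simp; omega)
      simp [mulTerm, coeff_mono, this]
    · have : (dx K)^[l + 1] (if n + (l + 1 : ℕ) - i = 1 then 1 else 0) = 0 := by
        rw [Function.iterate_succ_apply]
        split_ifs <;> simp [dx_one]
      simp only [mulTerm, coeff_mono]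
      rw [this]
      simp

/-- Only the commutator with `∂ = L_{≥0}` could matter, and its coefficient at `∂^i` is `-∂ₓ X_i`,
which vanishes for `i ≥ 0`. -/
theorem pos_commutator_L {X : RAlg K} (h : pos X = 0) : pos (X * L - L * X) = 0 := by
  have e : X * L - L * X = (X * pos L - pos L * X) + (X * neg L - neg L * X) := by
    conv_lhs => rw [← pos_add_neg (L : RAlg K)]
    noncomm_ring
  have hL : pos (neg (L : RAlg K)) = 0 := pos_neg _
  rw [e, map_add, map_sub pos (X * neg L), pos_mul_eq_zero h hL, pos_mul_eq_zero hL h, sub_zero,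
    add_zero, pos_eq_zero_iff]
  rw [pos_eq_zero_iff] at h
  intro i hi
  have e1 : coeff (X * pos L - pos L * X).1 i
      = coeff (X.1 * mono 1 1) i - coeff (mono 1 1 * X.1) i := by
    rw [← pos_L_val]
    rfl
  rw [e1, coeff_mul_mono_one_one, coeff_mono_one_one_mul, h i hi, map_zero, add_zero, sub_self]

end Projections

/-! ## Series with coefficients in `𝓡` -/

section Series

variable {K : Type*} [Field K]

/-- All coefficients are differential operators. -/
def AllPos (f : WordSeries (RAlg K)) : Prop := ∀ w, neg (f w) = 0

/-- All coefficients have negative order. -/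
def AllNeg (f : WordSeries (RAlg K)) : Prop := ∀ w, pos (f w) = 0

theorem AllPos.mul {f g : WordSeries (RAlg K)} (hf : AllPos f) (hg : AllPos g) :
    AllPos (f * g) := fun w => by
  rw [WordSeries.mul_apply, map_sum]
  exact Finset.sum_eq_zero fun j _ => neg_mul_eq_zero (hf _) (hg _)

theorem AllNeg.mul {f g : WordSeries (RAlg K)} (hf : AllNeg f) (hg : AllNeg g) :
    AllNeg (f * g) := fun w => by
  rw [WordSeries.mul_apply, map_sum]
  exact Finset.sum_eq_zero fun j _ => pos_mul_eq_zero (hf _) (hg _)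

theorem AllNeg.add {f g : WordSeries (RAlg K)} (hf : AllNeg f) (hg : AllNeg g) :
    AllNeg (f + g) := fun w => by rw [WordSeries.add_apply, map_add, hf, hg, add_zero]

theorem AllPos.sub {f g : WordSeries (RAlg K)} (hf : AllPos f) (hg : AllPos g) :
    AllPos (f - g) := fun w => by rw [WordSeries.sub_apply, map_sub, hf, hg, sub_zero]

theorem allPos_one : AllPos (1 : WordSeries (RAlg K)) := fun w => by
  by_cases h : w = []
  · rw [h, WordSeries.one_nil, neg_one_eq_zero]
  · rw [WordSeries.one_of_ne h, map_zero]

theorem eq_zero_of_allPos_of_allNeg {f : WordSeries (RAlg K)} (hp : AllPos f) (hn : AllNeg f) :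
    f = 0 := funext fun w => by
  rw [← pos_add_neg (f w), hp, hn, add_zero, WordSeries.zero_apply]

variable (K)

/-- The series `1 - ∑ ℓ(P_w)_{<0} t_w`. -/
def negEll : WordSeries (RAlg K) := fun w => if w = [] then 1 else -neg (ellRev w.reverse)

/-- The series `1 + ∑ ℓ(P_w)_{≥0} t_w`. -/
def posEll : WordSeries (RAlg K) := fun w => if w = [] then 1 else pos (ellRev w.reverse)

/-- The series `1 - ∑ r(P_w)_{≥0} t_w`. -/
def posR : WordSeries (RAlg K) := fun w => if w = [] then 1 else -pos (rWord w)

/-- The series `1 + ∑ r(P_w)_{<0} t_w`. -/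
def negR : WordSeries (RAlg K) := fun w => if w = [] then 1 else neg (rWord w)

/-- The series `∑ L^m t_m`. -/
def powL : WordSeries (RAlg K)
  | [m] => L ^ (m : ℕ)
  | _ => 0

variable {K}

theorem negEll_nil : negEll K [] = 1 := rfl

theorem posEll_nil : posEll K [] = 1 := rfl

theorem posR_nil : posR K [] = 1 := rfl

theorem negR_nil : negR K [] = 1 := rfl

theorem negEll_of_ne {w : List ℕ+} (h : w ≠ []) : negEll K w = -neg (ellRev w.reverse) :=
  if_neg h

theorem posEll_of_ne {w : List ℕ+} (h : w ≠ []) : posEll K w = pos (ellRev w.reverse) :=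
  if_neg h

theorem posR_of_ne {w : List ℕ+} (h : w ≠ []) : posR K w = -pos (rWord w) := if_neg h

theorem negR_of_ne {w : List ℕ+} (h : w ≠ []) : negR K w = neg (rWord w) := if_neg h

theorem powL_singleton (m : ℕ+) : powL K [m] = L ^ (m : ℕ) := rfl

theorem powL_of_length {w : List ℕ+} (h : w.length ≠ 1) : powL K w = 0 := by
  rcases w with _ | ⟨m, _ | ⟨n, w⟩⟩
  · rfl
  · exact absurd rfl h
  · rfl

theorem mul_powL_nil (f : WordSeries (RAlg K)) : (f * powL K) [] = 0 := by
  rw [WordSeries.mul_nil, powL_of_length (by simp), mul_zero]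

theorem powL_mul_nil (f : WordSeries (RAlg K)) : (powL K * f) [] = 0 := by
  rw [WordSeries.mul_nil, powL_of_length (by simp), zero_mul]

theorem mul_powL_concat (f : WordSeries (RAlg K)) (w : List ℕ+) (m : ℕ+) :
    (f * powL K) (w ++ [m]) = f w * L ^ (m : ℕ) := by
  rw [WordSeries.mul_apply, Finset.sum_eq_single w.length]
  · rw [List.take_left, List.drop_left, powL_singleton]
  · intro j hj h
    rw [powL_of_length, mul_zero]
    simp only [List.length_drop, List.length_append, List.length_singleton]
    omega
  · simp

theorem powL_mul_cons (f : WordSeries (RAlg K)) (w : List ℕ+) (m : ℕ+) :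
    (powL K * f) (m :: w) = L ^ (m : ℕ) * f w := by
  rw [WordSeries.mul_apply, Finset.sum_eq_single 1]
  · rfl
  · intro j hj h
    rw [Finset.mem_range] at hj
    rw [powL_of_length, zero_mul]
    rw [List.length_take]
    omega
  · simp

theorem powL_mul_const (n : ℕ) :
    powL K * WordSeries.const (L ^ n) = WordSeries.const (L ^ n) * powL K := funext fun w => by
  rw [WordSeries.mul_const_apply, WordSeries.const_mul_apply]
  by_cases h : w.length = 1
  · obtain ⟨m, rfl⟩ := List.length_eq_one_iff.1 h
    rw [powL_singleton, ← pow_add, ← pow_add, add_comm]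
  · rw [powL_of_length h, zero_mul, mul_zero]

theorem iterate_mulL (n : ℕ) (X : RAlg K) : mulL^[n] X = X * L ^ n := by
  induction n with
  | zero => simp
  | succ n ih =>
    rw [Function.iterate_succ_apply', ih, pow_succ, ← mul_assoc]
    rfl

theorem iterate_Lmul (n : ℕ) (X : RAlg K) : Lmul^[n] X = L ^ n * X := by
  induction n with
  | zero => simp
  | succ n ih =>
    rw [Function.iterate_succ_apply', ih, pow_succ', mul_assoc]
    rfl

/-- The constant term `1` of `negEll` absorbs the case of a one-letter word, so the recursion for
`ℓ` takes a single form. -/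
theorem ellRev_concat (w : List ℕ+) (m : ℕ+) :
    (ellRev (w ++ [m]).reverse : RAlg K) = negEll K w * L ^ (m : ℕ) := by
  have hm : L ^ (m : ℕ) = (L * L ^ ((m : ℕ) - 1) : RAlg K) := by
    rw [← pow_succ', Nat.sub_add_cancel m.pos]
  rw [hm, List.reverse_append, List.reverse_singleton, List.singleton_append]
  by_cases h : w = []
  · subst h
    rw [List.reverse_nil, ellRev, iterate_mulL, negEll_nil, one_mul]
  · rw [negEll_of_ne h]
    obtain ⟨n, t, ht⟩ := List.exists_cons_of_ne_nil (mt List.reverse_eq_nil_iff.1 h)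
    rw [ht, ellRev, iterate_mulL, neg_mul, neg_mul, mul_assoc]

theorem rWord_cons (w : List ℕ+) (m : ℕ+) :
    (rWord (m :: w) : RAlg K) = L ^ (m : ℕ) * posR K w := by
  have hm : L ^ (m : ℕ) = (L ^ ((m : ℕ) - 1) * L : RAlg K) := by
    rw [← pow_succ, Nat.sub_add_cancel m.pos]
  rw [hm]
  rcases w with _ | ⟨n, t⟩
  · rw [rWord, iterate_Lmul, posR_nil, mul_one]
  · rw [posR_of_ne (by simp), rWord, iterate_Lmul, mul_neg, mul_neg, mul_assoc]

theorem ellRev_reverse_eq (w : List ℕ+) :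
    (ellRev w.reverse : RAlg K) = posEll K w - negEll K w := by
  by_cases h : w = []
  · rw [h, posEll_nil, negEll_nil, sub_self]
    rfl
  · rw [posEll_of_ne h, negEll_of_ne h, sub_neg_eq_add, pos_add_neg]

theorem rWord_eq (w : List ℕ+) : (rWord w : RAlg K) = negR K w - posR K w := by
  by_cases h : w = []
  · rw [h, posR_nil, negR_nil, sub_self]
    rfl
  · rw [posR_of_ne h, negR_of_ne h, sub_neg_eq_add, add_comm, pos_add_neg]

/-! ### Quasi-shuffles of coefficients -/

/-- The series with coefficients `F(P_w ∘ P_v)`, for the linear extension of `F`. -/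
def stuffleSeries (F : WordSeries (RAlg K)) (v : List ℕ+) : WordSeries (RAlg K) :=
  fun w => stuffle F w v

theorem stuffleSeries_nil (F : WordSeries (RAlg K)) : stuffleSeries F [] = F :=
  funext fun w => stuffle_nil_right F w

theorem stuffleSeries_sub (F G : WordSeries (RAlg K)) (v : List ℕ+) :
    stuffleSeries (F - G) v = stuffleSeries F v - stuffleSeries G v := by
  rw [eq_sub_iff_add_eq]
  funext w
  refine (stuffle_add (F - G) G w v).symm.trans ?_
  exact congrArg (fun H => stuffle H w v) (funext fun x => sub_add_cancel (F x) (G x))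

/-- The last letter of a quasi-shuffle of `u a` and `v b` is `a`, `b` or `a + b`. By `ellRev_concat`
the first case gives the term with `v ++ [b]`; the other two give the summands `1` and `powL` of the
middle factor. -/
theorem ellRev_stuffle_concat (v : List ℕ+) (b : ℕ+) :
    stuffleSeries (fun x => ellRev x.reverse) (v ++ [b]) =
      stuffleSeries (negEll K) (v ++ [b]) * powL K
        + stuffleSeries (negEll K) v * (1 + powL K) * WordSeries.const (L ^ (b : ℕ)) := by
  have h (c : ℕ+) (u v' : List ℕ+) :
      stuffle (fun x => negEll K x * L ^ (c : ℕ)) u v' = stuffle (negEll K) u v' * L ^ (c : ℕ) :=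
    (map_stuffle (AddMonoidHom.mulRight (L ^ (c : ℕ))) _ u v').symm
  funext w
  rw [WordSeries.add_apply, WordSeries.mul_const_apply, mul_add, mul_one, WordSeries.add_apply]
  rcases List.eq_nil_or_concat w with rfl | ⟨u, a, rfl⟩
  · rw [mul_powL_nil, mul_powL_nil, zero_add, add_zero]
    simp only [stuffleSeries]
    rw [stuffle_nil_left, ellRev_concat]
    exact congrArg (· * L ^ (b : ℕ)) (stuffle_nil_left (negEll K) v).symm
  · rw [List.concat_eq_append, mul_powL_concat, mul_powL_concat]
    simp only [stuffleSeries, stuffle_concat_concat, ellRev_concat, h]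
    rw [PNat.add_coe, pow_add]
    noncomm_ring

/-- Mirror image of `ellRev_stuffle_concat`, sorting by first letters. -/
theorem rWord_stuffle_cons (v : List ℕ+) (b : ℕ+) :
    stuffleSeries rWord (b :: v) = powL K * stuffleSeries (posR K) (b :: v)
        + WordSeries.const (L ^ (b : ℕ)) * ((1 + powL K) * stuffleSeries (posR K) v) := by
  have h (c : ℕ+) (u v' : List ℕ+) :
      stuffle (fun x => L ^ (c : ℕ) * posR K x) u v' = L ^ (c : ℕ) * stuffle (posR K) u v' :=
    (map_stuffle (AddMonoidHom.mulLeft (L ^ (c : ℕ))) _ u v').symm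
  funext w
  rw [WordSeries.add_apply, WordSeries.const_mul_apply, add_mul, one_mul, WordSeries.add_apply]
  rcases w with _ | ⟨a, u⟩
  · rw [powL_mul_nil, powL_mul_nil, zero_add, add_zero]
    simp only [stuffleSeries]
    rw [stuffle_nil_left, rWord_cons]
    exact congrArg (L ^ (b : ℕ) * ·) (stuffle_nil_left (posR K) v).symm
  · rw [powL_mul_cons, powL_mul_cons]
    simp only [stuffleSeries, stuffle_cons_cons, rWord_cons, h]
    rw [add_comm a b, PNat.add_coe, pow_add]
    noncomm_ring

theorem stuffleSeries_posEll_eq (v : List ℕ+) :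
    stuffleSeries (posEll K) v
      = stuffleSeries (negEll K) v + stuffleSeries (fun x => ellRev x.reverse) v := by
  rw [← sub_eq_iff_eq_add', ← stuffleSeries_sub]
  exact congrArg (fun F => stuffleSeries F v) (funext fun w => (ellRev_reverse_eq w).symm)

theorem stuffleSeries_negR_eq (v : List ℕ+) :
    stuffleSeries (negR K) v = stuffleSeries (posR K) v + stuffleSeries rWord v := by
  rw [← sub_eq_iff_eq_add', ← stuffleSeries_sub]
  exact congrArg (fun F => stuffleSeries F v) (funext fun w => (rWord_eq w).symm)

theorem stuffleSeries_posEll_apply {v : List ℕ+} (hv : v ≠ []) (w : List ℕ+) :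
    stuffleSeries (posEll K) v w = pos (stuffle (fun x => ellRev x.reverse) w v) :=
  (stuffle_congr (fun _ hx => posEll_of_ne hx) w hv).trans
    (map_stuffle (pos (K := K)).toAddMonoidHom _ w v).symm

theorem stuffleSeries_negEll_apply {v : List ℕ+} (hv : v ≠ []) (w : List ℕ+) :
    stuffleSeries (negEll K) v w = -neg (stuffle (fun x => ellRev x.reverse) w v) :=
  (stuffle_congr (fun _ hx => negEll_of_ne hx) w hv).trans
    (map_stuffle (-(neg (K := K)).toAddMonoidHom) _ w v).symm

theorem stuffleSeries_posR_apply {v : List ℕ+} (hv : v ≠ []) (w : List ℕ+) :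
    stuffleSeries (posR K) v w = -pos (stuffle rWord w v) :=
  (stuffle_congr (fun _ hx => posR_of_ne hx) w hv).trans
    (map_stuffle (-(pos (K := K)).toAddMonoidHom) _ w v).symm

theorem stuffleSeries_negR_apply {v : List ℕ+} (hv : v ≠ []) (w : List ℕ+) :
    stuffleSeries (negR K) v w = neg (stuffle rWord w v) :=
  (stuffle_congr (fun _ hx => negR_of_ne hx) w hv).trans
    (map_stuffle (neg (K := K)).toAddMonoidHom _ w v).symm

/-! ### The factorizations of `1 + ∑ L^m t_m` -/

theorem posEll_eq : posEll K = negEll K * (1 + powL K) := funext fun w => by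
  rw [mul_add, mul_one, WordSeries.add_apply, ← sub_eq_iff_eq_add', ← ellRev_reverse_eq]
  rcases List.eq_nil_or_concat w with rfl | ⟨u, a, rfl⟩
  · rw [mul_powL_nil]
    rfl
  · rw [List.concat_eq_append, mul_powL_concat, ellRev_concat]

theorem negR_eq : negR K = (1 + powL K) * posR K := funext fun w => by
  rw [add_mul, one_mul, WordSeries.add_apply, ← sub_eq_iff_eq_add', ← rWord_eq]
  rcases w with _ | ⟨a, u⟩
  · rw [powL_mul_nil]
    rfl
  · rw [powL_mul_cons, rWord_cons]

theorem allPos_posEll : AllPos (posEll K) := fun w => by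
  by_cases h : w = []
  · rw [h, posEll_nil, neg_one_eq_zero]
  · rw [posEll_of_ne h, neg_pos]

theorem allPos_posR : AllPos (posR K) := fun w => by
  by_cases h : w = []
  · rw [h, posR_nil, neg_one_eq_zero]
  · rw [posR_of_ne h, map_neg, neg_pos, neg_zero]

theorem allNeg_negEll_sub_one : AllNeg (negEll K - 1) := fun w => by
  rw [WordSeries.sub_apply]
  by_cases h : w = []
  · rw [h, negEll_nil, WordSeries.one_nil, sub_self, map_zero]
  · rw [negEll_of_ne h, WordSeries.one_of_ne h, sub_zero, map_neg, pos_neg, neg_zero]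

theorem allNeg_negR_sub_one : AllNeg (negR K - 1) := fun w => by
  rw [WordSeries.sub_apply]
  by_cases h : w = []
  · rw [h, negR_nil, WordSeries.one_nil, sub_self, map_zero]
  · rw [negR_of_ne h, WordSeries.one_of_ne h, sub_zero, pos_neg]

theorem posEll_mul_posR_eq : posEll K * posR K = negEll K * negR K := by
  rw [posEll_eq, negR_eq, mul_assoc]

/-- Uniqueness of the splitting into differential and negative-order parts: this product minus `1`
has only negative-order coefficients, yet equals `posEll K * posR K - 1`, whose coefficients are
differential operators. -/
theorem negEll_mul_negR : negEll K * negR K = 1 := by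
  rw [← sub_eq_zero]
  apply eq_zero_of_allPos_of_allNeg
  · rw [← posEll_mul_posR_eq]
    exact (allPos_posEll.mul allPos_posR).sub allPos_one
  · have : negEll K * negR K - 1
        = (negEll K - 1) + (negR K - 1) + (negEll K - 1) * (negR K - 1) := by noncomm_ring
    rw [this]
    exact (allNeg_negEll_sub_one.add allNeg_negR_sub_one).add
      (allNeg_negEll_sub_one.mul allNeg_negR_sub_one)

theorem posEll_mul_posR : posEll K * posR K = 1 := by
  rw [posEll_mul_posR_eq, negEll_mul_negR]

theorem negR_mul_negEll : negR K * negEll K = 1 :=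
  WordSeries.mul_eq_one_comm_of_nil negEll_nil negEll_mul_negR

theorem one_add_powL_mul_const (n : ℕ) :
    (1 + powL K) * WordSeries.const (L ^ n) = WordSeries.const (L ^ n) * (1 + powL K) := by
  rw [add_mul, mul_add, powL_mul_const, one_mul, mul_one]

/-- The difference of the positive and negative parts of the action on `ℓ(P_{vb})`. -/
theorem stuffleSeries_ell_identity (v : List ℕ+) (b : ℕ+) :
    stuffleSeries (posEll K) (v ++ [b]) * posR K - stuffleSeries (negEll K) (v ++ [b]) * negR K
      = stuffleSeries (negEll K) v * WordSeries.const (L ^ (b : ℕ)) * negR K := by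
  -- With `1 + powL` moved past the power of `L`, the multiples of `(1 + powL) * posR = negR` coming
  -- from `v ++ [b]` cancel.
  rw [stuffleSeries_posEll_eq, ellRev_stuffle_concat, negR_eq,
    mul_assoc (stuffleSeries (negEll K) v), one_add_powL_mul_const]
  noncomm_ring

/-- The difference of the negative and positive parts of the action on `r(P_{bv})`. -/
theorem stuffleSeries_r_identity (v : List ℕ+) (b : ℕ+) :
    negEll K * stuffleSeries (negR K) (b :: v) - posEll K * stuffleSeries (posR K) (b :: v)
      = posEll K * WordSeries.const (L ^ (b : ℕ)) * stuffleSeries (posR K) v := by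
  rw [stuffleSeries_negR_eq, rWord_stuffle_cons, posEll_eq, mul_assoc (negEll K) (1 + powL K),
    mul_assoc (negEll K) (1 + powL K) (WordSeries.const _), one_add_powL_mul_const]
  noncomm_ring

end Series

/-! ## Consequences of the rules for `δ` -/

section Delta

variable {K : Type*} [Field K]

theorem ell_P_word (w : List ℕ+) : ell (P w : AP K) = ellRev w.reverse := by
  by_cases h : w = []
  · rw [h, P, dif_neg (by simp), map_zero]
    rfl
  · rw [P_ne h, ell_single]

theorem r_P_word (w : List ℕ+) : r (P w : AP K) = rWord w := by
  by_cases h : w = []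
  · rw [h, P, dif_neg (by simp), map_zero]
    rfl
  · rw [P_ne h, r_single]

/-- The rule for `δ L` says that the series `∑ (δ_w L) t_w` arises from `L` by conjugation. -/
theorem apply_L_iff {D : WordSeries (RAlg K)} (h0 : D [] = L) :
    (∀ w : List ℕ+, w ≠ [] → D w = -(neg (ell (P w)) * L - L * neg (ell (P w)))
      + ∑ j ∈ Finset.Ico 1 w.length, D (w.take j) * neg (ell (P (w.drop j))))
    ↔ D * negEll K = negEll K * WordSeries.const L := by
  have key (w : List ℕ+) (hw : w ≠ []) : (D * negEll K) w - negEll K w * L = D w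
      - (-(neg (ell (P w)) * L - L * neg (ell (P w)))
      + ∑ j ∈ Finset.Ico 1 w.length, D (w.take j) * neg (ell (P (w.drop j)))) := by
    have hs : ∑ j ∈ Finset.Ico 1 w.length, D (w.take j) * negEll K (w.drop j)
        = -∑ j ∈ Finset.Ico 1 w.length, D (w.take j) * neg (ell (P (w.drop j))) := by
      rw [← Finset.sum_neg_distrib]
      refine Finset.sum_congr rfl fun j hj => ?_
      rw [Finset.mem_Ico] at hj
      rw [negEll_of_ne, ell_P_word, mul_neg]
      rw [ne_eq, List.drop_eq_nil_iff]
      omega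
    -- The outer terms of the product at `w` are `D w` and `-L * neg (ell (P w))`; the latter
    -- supplies half of the commutator, and `negEll K w * L` the other half.
    rw [WordSeries.mul_apply_of_ne _ _ hw, hs, h0, negEll_nil, negEll_of_ne hw, ell_P_word]
    noncomm_ring
  constructor
  · intro h
    funext w
    rw [WordSeries.mul_const_apply]
    by_cases hw : w = []
    · rw [hw, WordSeries.mul_nil, h0, negEll_nil, one_mul, mul_one]
    · rw [← sub_eq_zero, key w hw, sub_eq_zero]
      exact h w hw
  · intro h w hw
    rw [← sub_eq_zero, ← key w hw, h, WordSeries.mul_const_apply, sub_self]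

/-- Induction on word length: the commutator term has negative order by `pos_commutator_L`, and each
product has two factors of negative order. -/
theorem pos_eq_zero_of_conj {D : WordSeries (RAlg K)} (h0 : D [] = L)
    (h : D * negEll K = negEll K * WordSeries.const L) (w : List ℕ+) (hw : w ≠ []) :
    pos (D w) = 0 := by
  induction hn : w.length using Nat.strong_induction_on generalizing w with
  | _ n ih =>
    have hc : pos (neg (ell (P w : AP K)) * L - L * neg (ell (P w))) = 0 :=
      pos_commutator_L (pos_neg _)
    rw [(apply_L_iff h0).2 h w hw, map_add, map_neg pos, hc, neg_zero, zero_add, map_sum]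
    refine Finset.sum_eq_zero fun j hj => ?_
    rw [Finset.mem_Ico] at hj
    refine pos_mul_eq_zero (ih j (by omega) _ ?_ ?_) (pos_neg _)
    · rw [ne_eq, List.take_eq_nil_iff]
      rintro (h | h)
      · omega
      · exact hw h
    · rw [List.length_take]
      omega

/-- The series `∑ (δ_w X) t_w`. -/
def deltaSeries (δ : List ℕ+ → RAlg K →ₗ[K] RAlg K) (X : RAlg K) : WordSeries (RAlg K) :=
  fun w => δ w X

variable {δ : List ℕ+ → RAlg K →ₗ[K] RAlg K}

namespace IsDelta

variable (hδ : IsDelta δ)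
include hδ

theorem series_nil (X : RAlg K) : deltaSeries δ X [] = X := by
  rw [deltaSeries, hδ.nil]
  rfl

theorem series_mul (X Y : RAlg K) :
    deltaSeries δ (X * Y) = deltaSeries δ X * deltaSeries δ Y :=
  funext fun w => hδ.apply_mul w X Y

/-- The rules do not prescribe the images of `1`. But its series is idempotent with constant term
`1`, and such a series can be cancelled. -/
theorem series_one : deltaSeries δ 1 = 1 := by
  rw [← sub_eq_zero]
  apply WordSeries.eq_zero_of_mul_eq_zero (hδ.series_nil 1)
  rw [mul_sub, mul_one, ← hδ.series_mul, mul_one, sub_self]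

theorem series_L_mul : deltaSeries δ L * negEll K = negEll K * WordSeries.const L :=
  (apply_L_iff (hδ.series_nil L)).1 hδ.apply_L

theorem series_L_pow_mul (n : ℕ) :
    deltaSeries δ (L ^ n) * negEll K = negEll K * WordSeries.const (L ^ n) := by
  induction n with
  | zero => rw [pow_zero, hδ.series_one, ← WordSeries.one_eq, one_mul, mul_one]
  | succ n ih =>
    rw [pow_succ, hδ.series_mul, mul_assoc, hδ.series_L_mul, ← mul_assoc, ih, mul_assoc,
      WordSeries.const_mul_const]

theorem series_L_pow (n : ℕ) :
    deltaSeries δ (L ^ n) = negEll K * WordSeries.const (L ^ n) * negR K := by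
  rw [← hδ.series_L_pow_mul, mul_assoc, negEll_mul_negR, mul_one]

theorem series_L : deltaSeries δ L = negEll K * WordSeries.const L * negR K := by
  simpa using hδ.series_L_pow 1

/-- Since `posEll = negEll * (1 + powL)` and `1 + powL` commutes with powers of `L`, conjugation by
`posEll` and by `negEll` agree on these powers. -/
theorem series_L_pow_mul_posEll (n : ℕ) :
    deltaSeries δ (L ^ n) * posEll K = posEll K * WordSeries.const (L ^ n) := by
  rw [posEll_eq, ← mul_assoc, hδ.series_L_pow_mul, mul_assoc, mul_assoc, one_add_powL_mul_const]

theorem series_ell_concat (v : List ℕ+) (b : ℕ+)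
    (h : deltaSeries δ (negEll K v) = stuffleSeries (negEll K) v * negR K) :
    deltaSeries δ (ellRev (v ++ [b]).reverse)
      = stuffleSeries (posEll K) (v ++ [b]) * posR K
        - stuffleSeries (negEll K) (v ++ [b]) * negR K := by
  rw [stuffleSeries_ell_identity, ellRev_concat, hδ.series_mul, h, hδ.series_L_pow]
  -- The trailing `negR` of the series of `negEll K v` meets the leading `negEll` of that of `L ^
  -- b`.
  have := negR_mul_negEll (K := K)
  calc _ = stuffleSeries (negEll K) v * (negR K * negEll K)
        * WordSeries.const (L ^ (b : ℕ)) * negR K := by simp only [mul_assoc]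
    _ = _ := by rw [this, mul_one]

theorem apply_neg (w : List ℕ+) (X : RAlg K) : δ w (neg X) = neg (δ w X) := by
  simp only [neg, LinearMap.sub_apply, LinearMap.id_apply, map_sub, hδ.apply_pos]

/-- Induction through `series_ell_concat`: in the difference found there the first product consists
of differential operators and the second has negative order, so taking negative parts isolates the
second. -/
theorem series_negEll (v : List ℕ+) :
    deltaSeries δ (negEll K v) = stuffleSeries (negEll K) v * negR K := by
  induction v using List.reverseRecOn with
  | nil => rw [negEll_nil, hδ.series_one, stuffleSeries_nil, negEll_mul_negR]
  | append_singleton v b ih =>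
    have hne : v ++ [b] ≠ [] := by simp
    have hp : AllPos (stuffleSeries (posEll K) (v ++ [b])) := fun w => by
      rw [stuffleSeries_posEll_apply hne, neg_pos]
    have hn : AllNeg (stuffleSeries (negEll K) (v ++ [b])) := fun w => by
      rw [stuffleSeries_negEll_apply hne, map_neg, pos_neg, neg_zero]
    have hn' : AllNeg (stuffleSeries (negEll K) (v ++ [b]) * negR K) := by
      have : stuffleSeries (negEll K) (v ++ [b]) * negR K = stuffleSeries (negEll K) (v ++ [b])
          + stuffleSeries (negEll K) (v ++ [b]) * (negR K - 1) := by noncomm_ring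
      rw [this]
      exact hn.add (hn.mul allNeg_negR_sub_one)
    funext w
    have h1 := congrFun (hδ.series_ell_concat v b ih) w
    rw [negEll_of_ne hne, deltaSeries, map_neg, hδ.apply_neg]
    rw [deltaSeries, WordSeries.sub_apply] at h1
    rw [h1, map_sub, hp.mul allPos_posR w, neg_eq_self (hn' w), zero_sub, neg_neg]

theorem series_ell {v : List ℕ+} (hv : v ≠ []) :
    deltaSeries δ (ellRev v.reverse)
      = stuffleSeries (posEll K) v * posR K - stuffleSeries (negEll K) v * negR K := by
  rcases List.eq_nil_or_concat v with rfl | ⟨v, b, rfl⟩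
  · exact absurd rfl hv
  · rw [List.concat_eq_append]
    exact hδ.series_ell_concat v b (hδ.series_negEll v)

theorem series_r_cons (v : List ℕ+) (b : ℕ+)
    (h : deltaSeries δ (posR K v) = posEll K * stuffleSeries (posR K) v) :
    deltaSeries δ (rWord (b :: v))
      = negEll K * stuffleSeries (negR K) (b :: v)
        - posEll K * stuffleSeries (posR K) (b :: v) := by
  rw [stuffleSeries_r_identity, rWord_cons, hδ.series_mul, h, ← mul_assoc,
    hδ.series_L_pow_mul_posEll]

/-- The counterpart of `series_negEll`, now keeping the differential operator part. -/
theorem series_posR (v : List ℕ+) :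
    deltaSeries δ (posR K v) = posEll K * stuffleSeries (posR K) v := by
  induction v with
  | nil => rw [posR_nil, hδ.series_one, stuffleSeries_nil, posEll_mul_posR]
  | cons b v ih =>
    have hne : b :: v ≠ [] := by simp
    have hp : AllPos (stuffleSeries (posR K) (b :: v)) := fun w => by
      rw [stuffleSeries_posR_apply hne, map_neg, neg_pos, neg_zero]
    have hn : AllNeg (stuffleSeries (negR K) (b :: v)) := fun w => by
      rw [stuffleSeries_negR_apply hne, pos_neg]
    have hn' : AllNeg (negEll K * stuffleSeries (negR K) (b :: v)) := by
      have : negEll K * stuffleSeries (negR K) (b :: v) = stuffleSeries (negR K) (b :: v)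
          + (negEll K - 1) * stuffleSeries (negR K) (b :: v) := by noncomm_ring
      rw [this]
      exact hn.add (allNeg_negEll_sub_one.mul hn)
    funext w
    have h1 := congrFun (hδ.series_r_cons v b ih) w
    rw [posR_of_ne hne, deltaSeries, map_neg, hδ.apply_pos]
    rw [deltaSeries, WordSeries.sub_apply] at h1
    rw [h1, map_sub, hn' w, pos_eq_self (allPos_posEll.mul hp w), zero_sub, neg_neg]

theorem series_r {v : List ℕ+} (hv : v ≠ []) :
    deltaSeries δ (rWord v)
      = negEll K * stuffleSeries (negR K) v - posEll K * stuffleSeries (posR K) v := by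
  obtain ⟨b, v, rfl⟩ := List.exists_cons_of_ne_nil hv
  exact hδ.series_r_cons v b (hδ.series_posR v)

end IsDelta

/-! ### From series identities back to the formulas for `ℓ` and `r` -/

theorem ell_Pcirc_P (w : List ℕ+) {v : List ℕ+} (hv : v ≠ []) :
    ell (Pcirc w (P v : AP K)) = stuffle (fun x => ellRev x.reverse) w v := by
  rw [Pcirc_P w hv]
  refine (map_stuffle (ell (K := K)).toAddMonoidHom _ w v).trans ?_
  exact congrArg (fun F => stuffle F w v) (funext fun x => ell_P_word x)

theorem r_Pcirc_P (w : List ℕ+) {v : List ℕ+} (hv : v ≠ []) :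
    r (Pcirc w (P v : AP K)) = stuffle rWord w v := by
  rw [Pcirc_P w hv]
  refine (map_stuffle (r (K := K)).toAddMonoidHom _ w v).trans ?_
  exact congrArg (fun F => stuffle F w v) (funext fun x => r_P_word x)

theorem IsDelta.apply_ell_P (hδ : IsDelta δ) (w : List ℕ+) {v : List ℕ+} (hv : v ≠ []) :
    δ w (ell (P v)) = ell (Pcirc w (P v))
      - ∑ j ∈ Finset.range w.length, tri (ell (Pcirc (w.take j) (P v))) (r (P (w.drop j))) := by
  have h := congrFun (hδ.series_ell hv) w
  rw [ell_P_word]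
  refine h.trans ?_
  -- At `j = w.length` the right factors are `1`, and positive part plus negative part is the
  -- leading term `ell (Pcirc w (P v))`. All other terms are `-tri`.
  rw [WordSeries.sub_apply, WordSeries.mul_apply, WordSeries.mul_apply,
    ← Finset.sum_sub_distrib, Finset.sum_range_succ, List.take_length, List.drop_length, posR_nil,
    negR_nil, mul_one, mul_one, stuffleSeries_posEll_eq, WordSeries.add_apply,
    add_sub_cancel_left, add_comm, sub_eq_add_neg, ← Finset.sum_neg_distrib, ell_Pcirc_P w hv]
  refine congrArg₂ _ rfl (Finset.sum_congr rfl fun j hj => ?_)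
  rw [Finset.mem_range] at hj
  have hd : w.drop j ≠ [] := by
    rw [ne_eq, List.drop_eq_nil_iff]
    omega
  rw [← stuffleSeries_posEll_eq, stuffleSeries_posEll_apply hv, stuffleSeries_negEll_apply hv,
    posR_of_ne hd, negR_of_ne hd, tri, ell_Pcirc_P _ hv, r_P_word]
  noncomm_ring

theorem IsDelta.apply_r_P (hδ : IsDelta δ) (w : List ℕ+) {v : List ℕ+} (hv : v ≠ []) :
    δ w (r (P v)) = r (Pcirc w (P v))
      + ∑ j ∈ Finset.Icc 1 w.length, tri (ell (P (w.take j))) (r (Pcirc (w.drop j) (P v))) := by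
  have h := congrFun (hδ.series_r hv) w
  rw [r_P_word]
  refine h.trans ?_
  have hI : Finset.Icc 1 w.length = Finset.Ico (0 + 1) (w.length + 1) := by
    ext j
    simp only [Finset.mem_Icc, Finset.mem_Ico]
    omega
  -- Here `j = 0` yields the leading term, since the left factors are then `1`.
  rw [WordSeries.sub_apply, WordSeries.mul_apply, WordSeries.mul_apply,
    ← Finset.sum_sub_distrib, Finset.range_eq_Ico, Finset.sum_eq_sum_Ico_succ_bot (by omega),
    List.take_zero, List.drop_zero, posEll_nil, negEll_nil, one_mul, one_mul, hI,
    stuffleSeries_negR_eq, WordSeries.add_apply, add_sub_cancel_left, r_Pcirc_P w hv]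
  refine congrArg₂ _ rfl (Finset.sum_congr rfl fun j hj => ?_)
  rw [Finset.mem_Ico] at hj
  have hd : w.take j ≠ [] := by
    rw [ne_eq, List.take_eq_nil_iff]
    rintro (h | h)
    · omega
    · rw [h, List.length_nil] at hj
      omega
  rw [← stuffleSeries_negR_eq, stuffleSeries_negR_apply hv, stuffleSeries_posR_apply hv,
    posEll_of_ne hd, negEll_of_ne hd, tri, r_Pcirc_P _ hv, ell_P_word]
  noncomm_ring

/-- `α ↦ P_w ∘ α` as a linear map. -/
def PcircHom (w : List ℕ+) : AP K →ₗ[K] AP K := if w = [] then LinearMap.id else circ (P w)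

theorem PcircHom_apply (w : List ℕ+) (α : AP K) : PcircHom w α = Pcirc w α := by
  rw [PcircHom, Pcirc]
  split_ifs <;> rfl

/-- `△` as a bilinear map. -/
def triHom : RAlg K →ₗ[K] RAlg K →ₗ[K] RAlg K :=
  (LinearMap.mul K (RAlg K)).compl₁₂ pos pos - (LinearMap.mul K (RAlg K)).compl₁₂ neg neg

theorem triHom_apply (X Y : RAlg K) : triHom X Y = tri X Y := rfl

theorem IsDelta.apply_ell (hδ : IsDelta δ) (w : List ℕ+) (α : AP K) :
    δ w (ell α) = ell (Pcirc w α)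
      - ∑ j ∈ Finset.range w.length, tri (ell (Pcirc (w.take j) α)) (r (P (w.drop j))) := by
  have h : δ w ∘ₗ ell = ell ∘ₗ PcircHom w - ∑ j ∈ Finset.range w.length,
      triHom.flip (r (P (w.drop j))) ∘ₗ ell ∘ₗ PcircHom (w.take j) := by
    refine Finsupp.lhom_ext' fun v => LinearMap.ext_ring ?_
    have := hδ.apply_ell_P w v.2
    rw [P_ne v.2] at this
    simpa [LinearMap.sum_apply, PcircHom_apply, triHom_apply] using this
  simpa [LinearMap.sum_apply, PcircHom_apply, triHom_apply] using congrArg (fun φ => φ α) h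

theorem IsDelta.apply_r (hδ : IsDelta δ) (w : List ℕ+) (α : AP K) :
    δ w (r α) = r (Pcirc w α)
      + ∑ j ∈ Finset.Icc 1 w.length, tri (ell (P (w.take j))) (r (Pcirc (w.drop j) α)) := by
  have h : δ w ∘ₗ r = r ∘ₗ PcircHom w + ∑ j ∈ Finset.Icc 1 w.length,
      triHom (ell (P (w.take j))) ∘ₗ r ∘ₗ PcircHom (w.drop j) := by
    refine Finsupp.lhom_ext' fun v => LinearMap.ext_ring ?_
    have := hδ.apply_r_P w v.2
    rw [P_ne v.2] at this
    simpa [LinearMap.sum_apply, PcircHom_apply, triHom_apply] using this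
  simpa [LinearMap.sum_apply, PcircHom_apply, triHom_apply] using congrArg (fun φ => φ α) h

end Delta

/-! ## Uniqueness -/

section Uniqueness

variable {K : Type*} [Field K]

/-- `∂⁻¹` as an element of `𝓡`. -/
def dinvR : RAlg K := ⟨PsiDO.dinv K, Generated.dinv⟩

theorem pos_L_mul_dinvR : (pos L * dinvR : RAlg K) = 1 := Subtype.ext <| by
  change (pos L : RAlg K).1 * PsiDO.dinv K = mono 1 0
  rw [pos_L_val, dinv_eq_mono, mono_one_one_mul_mono]
  rfl

theorem dinvR_mul_pos_L : (dinvR * pos L : RAlg K) = 1 := Subtype.ext <| by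
  change PsiDO.dinv K * (pos L : RAlg K).1 = mono 1 0
  rw [pos_L_val, dinv_eq_mono, mono_neg_one_mul_mono]
  rfl

namespace IsDelta

variable {δ δ' : List ℕ+ → RAlg K →ₗ[K] RAlg K}

/-- All higher coefficients of the series of `L` have negative order, so `∂ = L_{≥0}` is fixed. -/
theorem series_pos_L (hδ : IsDelta δ) : deltaSeries δ (pos L) = WordSeries.const (pos L) :=
  funext fun w => by
    rw [deltaSeries, hδ.apply_pos]
    by_cases hw : w = []
    · rw [hw, hδ.nil]
      rfl
    · rw [WordSeries.const_of_ne _ hw]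
      exact pos_eq_zero_of_conj (hδ.series_nil L) hδ.series_L_mul w hw

/-- A multiplicative unital map that fixes `∂` fixes its inverse. -/
theorem series_dinvR (hδ : IsDelta δ) : deltaSeries δ dinvR = WordSeries.const dinvR := by
  have h := hδ.series_mul (pos L) dinvR
  rw [pos_L_mul_dinvR, hδ.series_one, hδ.series_pos_L] at h
  calc deltaSeries δ dinvR
      = WordSeries.const (dinvR * pos L) * deltaSeries δ dinvR := by
        rw [dinvR_mul_pos_L, ← WordSeries.one_eq, one_mul]
    _ = WordSeries.const dinvR := by
        rw [← WordSeries.const_mul_const, mul_assoc, ← h, mul_one]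

theorem unique (hδ : IsDelta δ) (hδ' : IsDelta δ') : δ = δ' := by
  have key : ∀ X : PsiDO K, ∀ hX : Generated K X,
      deltaSeries δ (⟨X, hX⟩ : RAlg K) = deltaSeries δ' (⟨X, hX⟩ : RAlg K) := by
    intro X hX
    induction hX with
    | L => exact hδ.series_L.trans hδ'.series_L.symm
    | dinv => exact hδ.series_dinvR.trans hδ'.series_dinvR.symm
    | @add X Y hX hY h1 h2 =>
      funext w
      have e1 := (δ w).map_add ⟨X, hX⟩ ⟨Y, hY⟩
      have e2 := (δ' w).map_add ⟨X, hX⟩ ⟨Y, hY⟩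
      exact e1.trans ((congrArg₂ _ (congrFun h1 w) (congrFun h2 w)).trans e2.symm)
    | @smul c X hX h1 =>
      funext w
      have e1 := (δ w).map_smul c ⟨X, hX⟩
      have e2 := (δ' w).map_smul c ⟨X, hX⟩
      exact e1.trans ((congrArg _ (congrFun h1 w)).trans e2.symm)
    | @mul X Y hX hY h1 h2 =>
      have e1 := hδ.series_mul ⟨X, hX⟩ ⟨Y, hY⟩
      have e2 := hδ'.series_mul ⟨X, hX⟩ ⟨Y, hY⟩
      exact e1.trans ((congrArg₂ _ h1 h2).trans e2.symm)
    | @nonneg X hX h1 =>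
      funext w
      have e1 := hδ.apply_pos w ⟨X, hX⟩
      have e2 := hδ'.apply_pos w ⟨X, hX⟩
      exact e1.trans ((congrArg _ (congrFun h1 w)).trans e2.symm)
  funext w
  exact LinearMap.ext fun X => congrFun (key X.1 X.2) w

end IsDelta

end Uniqueness

/-! ## Existence -/

section Existence

variable (K : Type*) [Field K]

/-- The series `∑ (δ_w L) t_w`. -/
def conjL : WordSeries (RAlg K) := negEll K * WordSeries.const L * negR K

variable {K}

theorem conjL_nil : conjL K [] = L := by
  rw [conjL, WordSeries.mul_nil, WordSeries.mul_nil, negEll_nil, negR_nil, one_mul, mul_one,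
    WordSeries.const_nil]

theorem conjL_mul_negEll : conjL K * negEll K = negEll K * WordSeries.const L := by
  rw [conjL, mul_assoc, negR_mul_negEll, mul_one]

theorem pos_conjL {w : List ℕ+} (hw : w ≠ []) : pos (conjL K w) = 0 :=
  pos_eq_zero_of_conj conjL_nil conjL_mul_negEll w hw

variable (K)

/-- The algebra map `f ↦ ∑ (δ_w f) t_w` on differential polynomials. -/
def diffPolySeries : DiffPoly K →ₐ[K] WordSeries (DiffPoly K) :=
  FreeAlgebra.lift K fun p : ℕ × ℕ =>
    (fun w => (dx K)^[p.2] (PsiDO.coeff (conjL K w).1 (-(p.1 + 1))) : List ℕ+ → DiffPoly K)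

variable {K}

theorem diffPolySeries_ι (n j : ℕ) (w : List ℕ+) :
    diffPolySeries K (FreeAlgebra.ι K (n, j)) w
      = (dx K)^[j] (PsiDO.coeff (conjL K w).1 (-(n + 1))) :=
  congrFun (FreeAlgebra.lift_ι_apply (A := WordSeries (DiffPoly K)) _ _) w

theorem coeff_L (i : ℤ) : PsiDO.coeff (L : RAlg K).1 i =
    if i = 1 then 1 else if i < 0 then FreeAlgebra.ι K ((-i - 1).toNat, 0) else 0 := rfl

theorem coeff_L_neg (n : ℕ) :
    PsiDO.coeff (L : RAlg K).1 (-(n + 1)) = FreeAlgebra.ι K (n, 0) := by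
  rw [coeff_L, if_neg (by omega), if_pos (by omega)]
  congr 2
  omega

theorem iterate_dx_ι (n j : ℕ) : (dx K)^[j] (FreeAlgebra.ι K (n, 0)) = FreeAlgebra.ι K (n, j) := by
  induction j with
  | zero => rfl
  | succ j ih => rw [Function.iterate_succ_apply', ih, dx_ι]

theorem diffPolySeries_algebraMap (c : K) (w : List ℕ+) :
    diffPolySeries K (algebraMap K _ c) w = if w = [] then algebraMap K _ c else 0 := by
  rw [AlgHom.commutes, Algebra.algebraMap_eq_smul_one, Algebra.algebraMap_eq_smul_one,
    WordSeries.smul_apply]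
  by_cases hw : w = []
  · rw [hw, WordSeries.one_nil, if_pos rfl]
  · rw [WordSeries.one_of_ne hw, if_neg hw, smul_zero]

theorem diffPolySeries_nil (f : DiffPoly K) : diffPolySeries K f [] = f := by
  induction f using FreeAlgebra.induction with
  | grade0 c => rw [diffPolySeries_algebraMap, if_pos rfl]
  | grade1 p => rw [diffPolySeries_ι, conjL_nil, coeff_L_neg, iterate_dx_ι]
  | mul a b ha hb => rw [map_mul, WordSeries.mul_nil, ha, hb]
  | add a b ha hb => rw [map_add, WordSeries.add_apply, ha, hb]

theorem dx_algebraMap (c : K) : dx K (algebraMap K _ c) = 0 := by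
  rw [Algebra.algebraMap_eq_smul_one, map_smul, dx_one, smul_zero]

/-- Both sides are twisted derivations in `f`, so they need only agree on generators, where the
choice of images of the derivatives ensures it. -/
theorem diffPolySeries_dx (f : DiffPoly K) (w : List ℕ+) :
    diffPolySeries K (dx K f) w = dx K (diffPolySeries K f w) := by
  induction f using FreeAlgebra.induction generalizing w with
  | grade0 c =>
    rw [dx_algebraMap, map_zero, WordSeries.zero_apply, diffPolySeries_algebraMap]
    split_ifs
    · rw [dx_algebraMap]
    · rw [map_zero]
  | grade1 p =>
    obtain ⟨n, j⟩ := p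
    rw [dx_ι, diffPolySeries_ι, diffPolySeries_ι, Function.iterate_succ_apply']
  | mul a b ha hb =>
    rw [dx_mul, map_add, map_mul, map_mul, map_mul, WordSeries.add_apply, WordSeries.mul_apply,
      WordSeries.mul_apply, WordSeries.mul_apply, map_sum, ← Finset.sum_add_distrib]
    refine Finset.sum_congr rfl fun j _ => ?_
    rw [ha, hb, dx_mul]
  | add a b ha hb =>
    rw [map_add, map_add, map_add, WordSeries.add_apply, WordSeries.add_apply, map_add, ha, hb]

theorem diffPolySeries_iterate_dx (l : ℕ) (f : DiffPoly K) (w : List ℕ+) :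
    diffPolySeries K ((dx K)^[l] f) w = (dx K)^[l] (diffPolySeries K f w) := by
  induction l with
  | zero => rfl
  | succ l ih => rw [Function.iterate_succ_apply', Function.iterate_succ_apply',
      diffPolySeries_dx, ih]

/-- The coefficient of `t_w` in `diffPolySeries`. -/
def diffPolyDelta (w : List ℕ+) : DiffPoly K →ₗ[K] DiffPoly K where
  toFun f := diffPolySeries K f w
  map_add' f g := by rw [map_add, WordSeries.add_apply]
  map_smul' c f := by rw [map_smul, WordSeries.smul_apply, RingHom.id_apply]

theorem diffPolyDelta_mul (w : List ℕ+) (f g : DiffPoly K) :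
    diffPolyDelta w (f * g) = ∑ j ∈ Finset.range (w.length + 1),
      diffPolyDelta (w.take j) f * diffPolyDelta (w.drop j) g := by
  change diffPolySeries K (f * g) w = _
  rw [map_mul, WordSeries.mul_apply]
  rfl

theorem diffPolyDelta_iterate_dx (l : ℕ) (f : DiffPoly K) (w : List ℕ+) :
    diffPolyDelta w ((dx K)^[l] f) = (dx K)^[l] (diffPolyDelta w f) :=
  diffPolySeries_iterate_dx l f w

theorem diffPolyDelta_one {w : List ℕ+} (hw : w ≠ []) : diffPolyDelta w (1 : DiffPoly K) = 0 := by
  change diffPolySeries K 1 w = 0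
  rw [map_one, WordSeries.one_of_ne hw]

/-! ### Extension from differential polynomials to pseudo-differential operators -/

open PsiDO in
/-- The coefficientwise action on pseudo-differential operators. -/
def psiDelta (w : List ℕ+) : PsiDO K →ₗ[K] PsiDO K where
  toFun X := ofFun (fun i => diffPolyDelta w (coeff X i)) (by
    obtain ⟨N, hN⟩ := X.exists_bound
    exact ⟨N, fun i hi => by rw [hN i hi, map_zero]⟩)
  map_add' X Y := PsiDO.ext fun i => by simp
  map_smul' c X := PsiDO.ext fun i => by simp

theorem coeff_psiDelta (w : List ℕ+) (X : PsiDO K) (i : ℤ) :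
    PsiDO.coeff (psiDelta w X) i = diffPolyDelta w (PsiDO.coeff X i) := rfl

theorem psiDelta_nil (X : PsiDO K) : psiDelta [] X = X :=
  PsiDO.ext fun i => diffPolySeries_nil (PsiDO.coeff X i)

theorem psiDelta_nonneg (w : List ℕ+) (X : PsiDO K) :
    psiDelta w (PsiDO.nonneg X) = PsiDO.nonneg (psiDelta w X) := PsiDO.ext fun i => by
  rw [coeff_psiDelta, PsiDO.coeff_nonneg, PsiDO.coeff_nonneg, coeff_psiDelta]
  split_ifs
  · rfl
  · rw [map_zero]

/-- The product is built from integer multiples, products of coefficients and `∂ₓ`, with all of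
which the coefficientwise homomorphism is compatible. -/
theorem psiDelta_mul (w : List ℕ+) (X Y : PsiDO K) :
    psiDelta w (X * Y) = ∑ j ∈ Finset.range (w.length + 1),
      psiDelta (w.take j) X * psiDelta (w.drop j) Y := PsiDO.ext fun n => by
  rw [coeff_psiDelta, PsiDO.coeff_mul, map_sum, Finset.sum_apply]
  simp only [PsiDO.coeff_mul]
  rw [← finsum_sum_comm _ _ fun j _ => mulTerm_finite _ _ n]
  refine ((diffPolyDelta w).toAddMonoidHom.map_finsum (mulTerm_finite X Y n)).trans ?_
  refine finsum_congr fun p => ?_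
  change diffPolyDelta w (mulTerm _ _ n p) = _
  simp only [mulTerm]
  rw [map_zsmul, diffPolyDelta_mul, Finset.smul_sum]
  refine Finset.sum_congr rfl fun j _ => ?_
  rw [diffPolyDelta_iterate_dx, coeff_psiDelta, coeff_psiDelta]

/-- In negative orders this is the choice of images of the generators. In orders `≥ 0` the
coefficients of `L` are constants, killed for `w ≠ []`, which matches `pos_conjL`. -/
theorem psiDelta_L (w : List ℕ+) : psiDelta w (PsiDO.L K) = (conjL K w).1 := by
  by_cases hw : w = []
  · rw [hw, psiDelta_nil, conjL_nil]
    rfl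
  refine PsiDO.ext fun i => ?_
  have h := pos_eq_zero_iff.1 (pos_conjL (K := K) hw) i
  rw [coeff_psiDelta]
  rcases lt_or_ge i 0 with hi | hi
  · obtain ⟨n, rfl⟩ : ∃ n : ℕ, i = -(n + 1) := ⟨(-i - 1).toNat, by omega⟩
    exact (congrArg _ (coeff_L_neg n)).trans (diffPolySeries_ι n 0 w)
  · rw [h hi]
    refine (congrArg _ (coeff_L i)).trans ?_
    rw [if_neg (not_lt.2 hi)]
    split_ifs
    · exact diffPolyDelta_one hw
    · exact map_zero _

theorem psiDelta_dinv {w : List ℕ+} (hw : w ≠ []) : psiDelta w (PsiDO.dinv K) = 0 :=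
  PsiDO.ext fun i => by
    rw [coeff_psiDelta, dinv_eq_mono, coeff_mono]
    split_ifs
    · rw [diffPolyDelta_one hw, map_zero]
      rfl
    · rw [map_zero, map_zero]
      rfl

theorem generated_sum {ι : Type*} (s : Finset ι) (f : ι → PsiDO K)
    (h : ∀ i ∈ s, Generated K (f i)) : Generated K (∑ i ∈ s, f i) :=
  (generatedSubmodule K).sum_mem h

theorem generated_psiDelta {X : PsiDO K} (hX : Generated K X) (w : List ℕ+) :
    Generated K (psiDelta w X) := by
  induction hX generalizing w with
  | L =>
    -- Stability of `𝓡` is free here: `conjL` was formed from series with coefficients in `𝓡`.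
    rw [psiDelta_L]
    exact (conjL K w).2
  | dinv =>
    by_cases hw : w = []
    · rw [hw, psiDelta_nil]
      exact Generated.dinv
    · rw [psiDelta_dinv hw]
      exact (generatedSubmodule K).zero_mem
  | add _ _ h1 h2 =>
    rw [map_add]
    exact (h1 w).add (h2 w)
  | smul c _ h =>
    rw [map_smul]
    exact (h w).smul c
  | mul _ _ h1 h2 =>
    rw [psiDelta_mul]
    exact generated_sum _ _ fun j _ => (h1 _).mul (h2 _)
  | nonneg _ h =>
    rw [psiDelta_nonneg]
    exact (h w).nonneg

variable (K)

/-- The generalized derivations on `𝓡`. -/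
def delta (w : List ℕ+) : RAlg K →ₗ[K] RAlg K :=
  (psiDelta w).restrict (p := generatedSubmodule K) (q := generatedSubmodule K)
    fun _ hX => generated_psiDelta hX w

variable {K}

theorem delta_L (w : List ℕ+) : delta K w L = conjL K w := Subtype.ext (psiDelta_L w)

theorem RAlg.val_sum {ι : Type*} (s : Finset ι) (f : ι → RAlg K) :
    (∑ i ∈ s, f i).1 = ∑ i ∈ s, (f i).1 :=
  map_sum (generatedSubmodule K).subtype f s

theorem isDelta_delta : IsDelta (delta K) where
  nil := LinearMap.ext fun X => Subtype.ext (psiDelta_nil X.1)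
  apply_L w hw := by
    simp only [delta_L]
    exact (apply_L_iff conjL_nil).2 conjL_mul_negEll w hw
  apply_pos w X := Subtype.ext (psiDelta_nonneg w X.1)
  apply_mul w X Y := Subtype.ext (by
    rw [RAlg.val_sum]
    exact psiDelta_mul w X.1 Y.1)

end Existence

end

end NcKP

theorem proposition6p2 (K : Type*) [Field K] [CharZero K] :
    (∃! δ : List ℕ+ → NcKP.RAlg K →ₗ[K] NcKP.RAlg K, NcKP.IsDelta δ) ∧
    ∀ δ : List ℕ+ → NcKP.RAlg K →ₗ[K] NcKP.RAlg K, NcKP.IsDelta δ →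
      ∀ (w : List ℕ+), w ≠ [] → ∀ α : NcKP.AP K,
        δ w (NcKP.ell α) = NcKP.ell (NcKP.Pcirc w α)
            - ∑ j ∈ Finset.range w.length,
                NcKP.tri (NcKP.ell (NcKP.Pcirc (w.take j) α)) (NcKP.r (NcKP.P (w.drop j))) ∧
        δ w (NcKP.r α) = NcKP.r (NcKP.Pcirc w α)
            + ∑ j ∈ Finset.Icc 1 w.length,
                NcKP.tri (NcKP.ell (NcKP.P (w.take j))) (NcKP.r (NcKP.Pcirc (w.drop j) α)) :=
  ⟨⟨NcKP.delta K, NcKP.isDelta_delta, fun _ hδ => hδ.unique NcKP.isDelta_delta⟩,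
    fun _ hδ w _ α => ⟨hδ.apply_ell w α, hδ.apply_r w α⟩⟩
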